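/- **Setting.** Let $G$ be a finite-dimensional real Lie group with Lie algebra $\mathfrak g$ and let $\langle\cdot,\cdot\rangle$ be a nondegenerate symmetric bilinear form on $\mathfrak g$ (not necessarily ad-invariant). Let $\mathfrak g=\mathfrak g_+\oplus\mathfrak g_-$ (direct sum of vector spaces) with Lie subalgebras $\mathfrak g_\pm$, and let $G_\pm$ be Lie subgroups of $G$ (injectively immersed) with Lie algebras $\mathfrak g_\pm$. For $X\in\mathfrak g$ let $\mathrm{ad}^t_X$ be defined by $\langle \mathrm{ad}^t_XY,Z\rangle=\langle Y,[X,Z]\rangle$; for $g\in G$ let $\tau(g)$ be defined by $\langle\tau(g)X,Y\rangle=\langle X,\mathrm{Ad}(g^{-1})Y\rangle$. For a smooth $f:\mathfrak g\to\mathbb R$ let $\nabla f(U)$ be defined by $\langle\nabla f(U),Y\rangle=df_U(Y)$, and let $\nabla f_+(U)\in\mathfrak g_+$, $\nabla f_-(U)\in\mathfrak g_-$ be its components. Call $f$ $\tau$-invariant if $f(\tau(g)U)=f(U)$ for all $g\in G$, $U\in\mathfrak g$. One has $\mathfrak g=\mathfrak g_+^\perp\oplus\mathfrak g_-^\perp$,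 with projection $\pi_{\mathfrak g_+^\perp}$ onto the first summand. The isomorphism $\mathfrak g_+^\perp\to\mathfrak g_-^*$, $X\mapsto\langle X,\cdot\rangle|_{\mathfrak g_-}$, transports the coadjoint action of $G_-$ on $\mathfrak g_-^*$ to an action $\tilde\tau$ of $G_-$ on $\mathfrak g_+^\perp$; for $Y\in\mathfrak g_-$ put $\tilde Y(U)=\frac{d}{ds}\big|_{s=0}\tilde\tau(\exp sY)U$. Let $\mathcal M\subset\mathfrak g_+^\perp$ be a $G_-$-orbit; its tangent space at $U$ is spanned by the vectors $\tilde Y(U)$, $Y\in\mathfrak g_-$, and its orbit symplectic form $\omega$ is the (well defined, alternating and nondegenerate) form $\omega_U(\tilde Y,\tilde Z)=\langle U,[Y,Z]\rangle$. The Hamiltonian vector field $X_H$ of a smooth function $H$ on $\mathcal M$ is defined by $dH_U(v)=\omega_U(v,X_H(U))$ for all $v\in T_U\mathcal M$, and $\{H_1,H_2\}=\omega(X_{H_1},X_{H_2})$. **Theorem.** Let $f:\mathfrak g\to\mathbb R$ be smooth and $H=f|_{\mathcal M}$. 1. For every $U\in\mathcal M$ there is exactly one Hamiltonian vector $X_H(U)$,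 and $$X_H(U)=-\widetilde{\nabla f_-(U)}(U)=\pi_{\mathfrak g_+^\perp}\big(\mathrm{ad}^t_{\nabla f_-(U)}U\big).$$ 2. If $f$ is $\tau$-invariant, then $X_H(U)=-\mathrm{ad}^t_{\nabla f_+(U)}U=\mathrm{ad}^t_{\nabla f_-(U)}U$ for all $U\in\mathcal M$; that is, the Hamiltonian equation for $H$ is $$\frac{du}{ds}=-\mathrm{ad}^t_{\nabla f_+(u)}u=\mathrm{ad}^t_{\nabla f_-(u)}u .$$ 3. If $f_1,f_2:\mathfrak g\to\mathbb R$ are smooth and $\tau$-invariant and $H_i=f_i|_{\mathcal M}$, then $\{H_1,H_2\}=0$ on $\mathcal M$. 4. Suppose that the multiplication map $G_+\times G_-\to G$, $(g_+,g_-)\mapsto g_+g_-$, is a diffeomorphism and that $f$ is $\tau$-invariant. Let $U_0\in\mathcal M$. For every $s\in\mathbb R$ there is exactly one factorization $\exp(s\nabla f(U_0))=g_+(s)g_-(s)$ with $g_\pm(s)\in G_\pm$. The initial value problem $$\frac{du}{ds}=-\mathrm{ad}^t_{\nabla f_+(u)}u,\qquad u(0)=U_0,$$ has the global solution $$u(s)=\tau\big(g_+(-s)^{-1}\big)U_0,\qquad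 s\in\mathbb R.$$ This solution stays in $\mathcal M$, and on every open interval around $0$ it is the only solution with values in $\mathfrak g$. -/

import Mathlib

open scoped Manifold ContDiff Topology

noncomputable section

namespace Transadjoint

section LieGroups

variable {E : Type*} [NormedAddCommGroup E] [NormedSpace ℝ E]
  {G : Type*} [TopologicalSpace G] [ChartedSpace E G] [Group G]

/-- The Lie algebra of `G`: the tangent space at the identity, with the bracket of left invariant
vector fields. -/
abbrev LieAlg (E : Type*) [NormedAddCommGroup E] [NormedSpace ℝ E]
    (G : Type*) [TopologicalSpace G] [ChartedSpace E G] [Group G] : Type _ :=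
  GroupLieAlgebra 𝓘(ℝ, E) G

instance instFiniteDimensionalLieAlg [FiniteDimensional ℝ E] :
    FiniteDimensional ℝ (LieAlg E G) :=
  inferInstanceAs (FiniteDimensional ℝ E)

/-- `c` is the integral curve, through the identity, of the left invariant vector field of `X`. -/
def IsOneParam (X : LieAlg E G) (c : ℝ → G) : Prop :=
  c 0 = 1 ∧ IsMIntegralCurve c (mulInvariantVectorField (I := 𝓘(ℝ, E)) X)

/-- The exponential map of `G`: the value at time `1` of the integral curve through the identity
of the left invariant vector field of `X`. -/
def exp (X : LieAlg E G) : G :=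
  Classical.epsilon fun g : G => ∃ c : ℝ → G, IsOneParam X c ∧ c 1 = g

/-- The adjoint representation: `Ad g` is the differential at the identity of `h ↦ g h g⁻¹`.
(All tangent spaces of `G` are by definition copies of the model space, so that the tangent space
at `g * 1 * g⁻¹` is literally the one at `1`.) -/
def Ad (g : G) : LieAlg E G →ₗ[ℝ] LieAlg E G :=
  ContinuousLinearMap.toLinearMap (M := LieAlg E G) (M₂ := LieAlg E G)
    (mfderiv 𝓘(ℝ, E) 𝓘(ℝ, E) (fun h : G => g * h * g⁻¹) (1 : G))

/-- The coadjoint representation, `(Ad* g) φ = φ ∘ Ad g⁻¹`. -/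
def coAd (g : G) (φ : Module.Dual ℝ (LieAlg E G)) : Module.Dual ℝ (LieAlg E G) :=
  φ ∘ₗ Ad g⁻¹

variable {F : Type*} [NormedAddCommGroup F] [NormedSpace ℝ F]
  {K : Type*} [TopologicalSpace K] [ChartedSpace F K] [Group K]

/-- The differential at the identity of a group homomorphism. -/
def differential (ι : K →* G) : LieAlg F K →ₗ[ℝ] LieAlg E G :=
  ContinuousLinearMap.toLinearMap (M := LieAlg F K) (M₂ := LieAlg E G)
    (mfderiv 𝓘(ℝ, F) 𝓘(ℝ, E) ι (1 : K))

/-- Smooth real valued functions on the Lie algebra. -/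
def IsSmooth (f : LieAlg E G → ℝ) : Prop := ContDiff ℝ ∞ (fun x : E => f x)

variable [CompleteSpace E] [LieGroup 𝓘(ℝ, E) ∞ G]

instance instLieGroupMinSmoothness : LieGroup 𝓘(ℝ, E) (minSmoothness ℝ 3) G :=
  LieGroup.of_le (n := ∞) (by simpa using (WithTop.coe_le_coe.2 le_top : ((3 : ℕ∞) : WithTop ℕ∞) ≤ ∞))

/-- `ι : K → G` exhibits `K` as an (immersed) Lie subgroup of `G` with Lie algebra `𝔥`. -/
structure IsLieSubgroup (ι : K →* G) (𝔥 : LieSubalgebra ℝ (LieAlg E G)) : Prop where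
  contMDiff : ContMDiff 𝓘(ℝ, F) 𝓘(ℝ, E) ∞ ι
  injective : Function.Injective ι
  differential_injective : Function.Injective (differential (E := E) (F := F) ι)
  range_differential : LinearMap.range (differential (E := E) (F := F) ι) = 𝔥.toSubmodule

section Form

variable [FiniteDimensional ℝ E] {B : LinearMap.BilinForm ℝ (LieAlg E G)} (hB : B.Nondegenerate)

/-- The transpose of `ad X`: `⟨adᵗ_X Y, Z⟩ = ⟨Y, [X, Z]⟩`. -/
def adT (X : LieAlg E G) : LieAlg E G →ₗ[ℝ] LieAlg E G :=
  B.leftAdjointOfNondegenerate hB (LieAlgebra.ad ℝ (LieAlg E G) X)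

/-- The transadjoint representation: `⟨τ(g) X, Y⟩ = ⟨X, Ad(g⁻¹) Y⟩`. -/
def tau (g : G) : LieAlg E G →ₗ[ℝ] LieAlg E G :=
  B.leftAdjointOfNondegenerate hB (Ad g⁻¹)

/-- The gradient: `⟨∇f(U), Y⟩ = df_U(Y)`. -/
def grad (f : LieAlg E G → ℝ) (U : LieAlg E G) : LieAlg E G :=
  (B.toDual hB).symm (fderiv ℝ f U : LieAlg E G →ₗ[ℝ] ℝ)

/-- `τ`-invariance of a function. -/
def IsTauInvariant (f : LieAlg E G → ℝ) : Prop :=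
  ∀ (g : G) (U : LieAlg E G), f (tau hB g U) = f U

end Form

end LieGroups

/-- A nondegenerate symmetric bilinear form on the Lie algebra `𝔤` of `G`, a decomposition
`𝔤 = 𝔤₊ ⊕ 𝔤₋` into Lie subalgebras, and a Lie subgroup `G₋` of `G` with Lie algebra `𝔤₋`. -/
structure Splitting
    (E : Type*) [NormedAddCommGroup E] [NormedSpace ℝ E] [CompleteSpace E]
    (G : Type*) [TopologicalSpace G] [ChartedSpace E G] [Group G] [LieGroup 𝓘(ℝ, E) ∞ G]
    (Em : Type*) [NormedAddCommGroup Em] [NormedSpace ℝ Em]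
    (Gm : Type*) [TopologicalSpace Gm] [ChartedSpace Em Gm] [Group Gm] where
  /-- the bilinear form -/
  form : LinearMap.BilinForm ℝ (LieAlg E G)
  symm : form.IsSymm
  nondeg : form.Nondegenerate
  /-- `𝔤₊` -/
  gp : LieSubalgebra ℝ (LieAlg E G)
  /-- `𝔤₋` -/
  gm : LieSubalgebra ℝ (LieAlg E G)
  isCompl : IsCompl gp.toSubmodule gm.toSubmodule
  /-- the inclusion of `G₋` in `G` -/
  incl : Gm →* G
  isLieSubgroup : IsLieSubgroup (F := Em) incl gm

namespace Splitting

variable {E : Type*} [NormedAddCommGroup E] [NormedSpace ℝ E] [FiniteDimensional ℝ E]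
  [CompleteSpace E]
  {G : Type*} [TopologicalSpace G] [ChartedSpace E G] [Group G] [LieGroup 𝓘(ℝ, E) ∞ G]
  {Em : Type*} [NormedAddCommGroup Em] [NormedSpace ℝ Em] [FiniteDimensional ℝ Em]
  {Gm : Type*} [TopologicalSpace Gm] [ChartedSpace Em Gm] [Group Gm]
  (D : Splitting E G Em Gm)

/-- `𝔤₊^⊥` -/
abbrev gpPerp : Submodule ℝ (LieAlg E G) := D.form.orthogonal D.gp.toSubmodule

/-- `𝔤₋^⊥` -/
abbrev gmPerp : Submodule ℝ (LieAlg E G) := D.form.orthogonal D.gm.toSubmodule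

/-- The differential of the inclusion, an isomorphism of the Lie algebra of `G₋` onto `𝔤₋`. -/
abbrev dIncl : LieAlg Em Gm →ₗ[ℝ] LieAlg E G := differential (E := E) (F := Em) D.incl

theorem isCompl_perp : IsCompl D.gpPerp D.gmPerp := by
  have hdisj : Disjoint D.gpPerp D.gmPerp := by
    rw [Submodule.disjoint_def]
    intro x hp hm
    refine D.nondeg.2 x fun y => ?_
    obtain ⟨a, ha, b, hb, rfl⟩ := Submodule.mem_sup.1
      (D.isCompl.sup_eq_top ▸ Submodule.mem_top : y ∈ D.gp.toSubmodule ⊔ D.gm.toSubmodule)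
    have h1 : D.form a x = 0 := hp a ha
    have h2 : D.form b x = 0 := hm b hb
    simp [h1, h2]
  refine (Submodule.isCompl_iff_disjoint _ _ ?_).2 hdisj
  have h1 := LinearMap.BilinForm.finrank_orthogonal D.nondeg D.gp.toSubmodule
  have h2 := LinearMap.BilinForm.finrank_orthogonal D.nondeg D.gm.toSubmodule
  have h3 := Submodule.finrank_add_eq_of_isCompl D.isCompl
  change Module.finrank ℝ D.gpPerp = _ at h1
  change Module.finrank ℝ D.gmPerp = _ at h2
  omega

/-- `X ↦ ℓ_X`, `ℓ_X(Y) = ⟨X, Y⟩`, from `𝔤₊^⊥` to the dual of the Lie algebra of `G₋`. -/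
def ell : D.gpPerp →ₗ[ℝ] Module.Dual ℝ (LieAlg Em Gm) where
  toFun X := (D.form X) ∘ₗ D.dIncl
  map_add' X Y := by ext; simp
  map_smul' c X := by ext; simp

theorem ell_bijective : Function.Bijective D.ell := by
  have hinj : Function.Injective D.ell := by
    rw [injective_iff_map_eq_zero]
    intro X hX
    apply Subtype.ext
    refine D.nondeg.2 _ fun y => ?_
    obtain ⟨a, ha, b, hb, rfl⟩ := Submodule.mem_sup.1
      (D.isCompl.sup_eq_top ▸ Submodule.mem_top : y ∈ D.gp.toSubmodule ⊔ D.gm.toSubmodule)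
    rw [← D.isLieSubgroup.range_differential] at hb
    obtain ⟨Y, rfl⟩ := hb
    have h1 : D.form a X = 0 := X.2 a ha
    have h2 : D.form X (D.dIncl Y) = 0 := LinearMap.congr_fun hX Y
    rw [D.symm.eq] at h2
    rw [map_add, LinearMap.add_apply, h1, zero_add]
    exact h2
  refine ⟨hinj, (LinearMap.injective_iff_surjective_of_finrank_eq_finrank ?_).1 hinj⟩
  have h1 := LinearMap.BilinForm.finrank_orthogonal D.nondeg D.gp.toSubmodule
  have h3 := Submodule.finrank_add_eq_of_isCompl D.isCompl
  have h4 := LinearMap.finrank_range_of_inj D.isLieSubgroup.differential_injective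
  rw [D.isLieSubgroup.range_differential] at h4
  change Module.finrank ℝ D.gpPerp = _ at h1
  rw [Subspace.dual_finrank_eq]
  omega

/-- The isomorphism of `𝔤₊^⊥` with the dual of the Lie algebra of `G₋`. -/
def ellEquiv : D.gpPerp ≃ₗ[ℝ] Module.Dual ℝ (LieAlg Em Gm) :=
  LinearEquiv.ofBijective D.ell D.ell_bijective

/-- The action of `G₋` on `𝔤₊^⊥` corresponding to the coadjoint action of `G₋`. -/
def tauTilde (g : Gm) (X : D.gpPerp) : D.gpPerp :=
  D.ellEquiv.symm (coAd g (D.ellEquiv X))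

/-- The `G₋`-orbit of a point of `𝔤₊^⊥`. -/
def orbit (P : D.gpPerp) : Set D.gpPerp := Set.range fun g : Gm => D.tauTilde g P

/-- The projection of `𝔤 = 𝔤₊^⊥ ⊕ 𝔤₋^⊥` onto `𝔤₊^⊥`. -/
def projPerp : LieAlg E G →ₗ[ℝ] LieAlg E G := D.gpPerp.projection D.gmPerp D.isCompl_perp

/-- The component in `𝔤₊` of the gradient, for `𝔤 = 𝔤₊ ⊕ 𝔤₋`. -/
def gradPlus (f : LieAlg E G → ℝ) (U : LieAlg E G) : LieAlg E G :=
  D.gp.toSubmodule.projection D.gm.toSubmodule D.isCompl (grad D.nondeg f U)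

/-- The component in `𝔤₋` of the gradient, for `𝔤 = 𝔤₊ ⊕ 𝔤₋`. -/
def gradMinus (f : LieAlg E G → ℝ) (U : LieAlg E G) : LieAlg E G :=
  D.gm.toSubmodule.projection D.gp.toSubmodule D.isCompl.symm (grad D.nondeg f U)

/-- The curve `s ↦ τ̃(exp sY) U` in the orbit of `U`. -/
def orbitCurve (Y : LieAlg Em Gm) (U : D.gpPerp) (s : ℝ) : LieAlg E G :=
  D.tauTilde (exp (s • Y)) U

/-- The infinitesimal vector field of `Y` on `𝔤₊^⊥`: `Ỹ(U) = d/ds|₀ τ̃(exp sY) U`. -/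
def infGen (Y : LieAlg Em Gm) (U : D.gpPerp) : LieAlg E G := deriv (D.orbitCurve Y U) 0

/-- The tangent space at `U` of the orbit of `U`. -/
def tangent (U : D.gpPerp) : Submodule ℝ (LieAlg E G) :=
  Submodule.span ℝ (Set.range fun Y : LieAlg Em Gm => D.infGen Y U)

/-- `Ỹ(U)` as a tangent vector of the orbit. -/
def tangentGen (Y : LieAlg Em Gm) (U : D.gpPerp) : D.tangent U :=
  ⟨D.infGen Y U, Submodule.subset_span ⟨Y, rfl⟩⟩

/-- The defining property of the orbit symplectic form at `U`: `Ω_U(Ỹ, Z̃) = ⟨U, [Y, Z]⟩`. As the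
vectors `Ỹ(U)` span the tangent space, at most one bilinear form has it. -/
def IsOrbitForm (U : D.gpPerp) (Ω : LinearMap.BilinForm ℝ (D.tangent U)) : Prop :=
  ∀ Y Z : LieAlg Em Gm,
    Ω (D.tangentGen Y U) (D.tangentGen Z U) = D.form U ⁅D.dIncl Y, D.dIncl Z⁆

/-- The orbit symplectic form at `U`. -/
def orbitForm (U : D.gpPerp) : LinearMap.BilinForm ℝ (D.tangent U) :=
  Classical.epsilon (D.IsOrbitForm U)

/-- `X` is the value at `U` of the Hamiltonian vector field of the restriction `H` of `f` to the
orbit of `U`: `dH_U(v) = Ω_U(v, X)` for every tangent vector `v = Ỹ(U)` of the orbit, where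
`dH_U(Ỹ(U))` is the derivative of `H` along the curve `s ↦ τ̃(exp sY) U`. -/
def IsHamiltonianVector (f : LieAlg E G → ℝ) (U : D.gpPerp) (X : D.tangent U) : Prop :=
  ∀ Y : LieAlg Em Gm,
    deriv (fun s : ℝ => f (D.orbitCurve Y U s)) 0 = D.orbitForm U (D.tangentGen Y U) X

/-- The Hamiltonian vector field of the restriction of `f` to the orbit. -/
def hamiltonianField (f : LieAlg E G → ℝ) (U : D.gpPerp) : D.tangent U :=
  Classical.epsilon (D.IsHamiltonianVector f U)

/-- The Poisson bracket `{H₁, H₂} = Ω(X_{H₁}, X_{H₂})` of the restrictions of two functions to the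
orbit. -/
def poissonBracket (f₁ f₂ : LieAlg E G → ℝ) (U : D.gpPerp) : ℝ :=
  D.orbitForm U (D.hamiltonianField f₁ U) (D.hamiltonianField f₂ U)

end Splitting

end Transadjoint

end

set_option linter.unusedSectionVars false

/-! Everything rests on one derivative: if a curve `γ` passes through `1` with velocity `ξ`, then
`Ad (γ t) Y` has derivative `⁅ξ, Y⁆`, and dually `τ(γ t) W` has derivative `-adᵗ_ξ W`
(`HasVelocityAtOne.hasDerivAt_Ad`, `HasVelocityAtOne.hasDerivAt_tau`).

The transported action is `τ̃(g) = π ∘ τ(g)`, with `π` the projection onto `𝔤₊^⊥`. Hence `Ỹ(U) =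
-π(adᵗ_Y U)` and `ω_U(Ỹ, Z̃) = -⟨Ỹ(U), Z⟩`. As `𝔤₊^⊥` is dual to `𝔤₋`, the form is well defined and
nondegenerate. Also `dH(Ỹ) = ⟨Ỹ(U), ∇f₋⟩`, because `𝔤₊` pairs to zero with `Ỹ(U)`; comparing the two
formulas gives the Hamiltonian vector.

For invariant `f`, differentiating `f(τ(γ)U) = f(U)` gives `adᵗ_{∇f(U)} U = 0` (`adT_grad_self`). So
`adᵗ_{∇f₋} U = -adᵗ_{∇f₊} U`, which already lies in `𝔤₊^⊥`. Trading minus for plus components in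
both slots of the Poisson bracket leaves a pairing of `𝔤₊^⊥` with `𝔤₊`, which is zero.

For the factorization, put `h(s) = g₊(-s)⁻¹`, `k(s) = g₋(-s)` and `u = τ(h)U₀`, so that `k = h ·
exp(-s∇f(U₀))`. With `η`, `κ` the right logarithmic derivatives of `h`, `k`, this gives `κ = η -
Ad(h)∇f(U₀) = η - ∇f(u)` by equivariance of the gradient (`grad_tau`). Thus `η = ∇f₊(u)` and `u' =
-adᵗ_η u`. Since `exp(-s∇f(U₀))` fixes `U₀`, also `u = τ(k)U₀ = τ̃(k)U₀`, a point of the orbit. -/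

noncomputable section

namespace Transadjoint

/-! ### Calculus in the model space: conjugation to second order, uniqueness for ODEs -/

section Calculus

variable {E : Type*} [NormedAddCommGroup E] [NormedSpace ℝ E]

/-- If `m` and `c` are germs of a group multiplication and of the corresponding conjugation
`c (x, y) = x y x⁻¹`, then the derivative in `x` of the derivative in `y` of `c` is the
antisymmetrization of the mixed second derivative of `m`. -/
theorem hasFDerivAt_fderiv_conj {m c : E × E → E} {x₀ : E}
    (hm : ContDiffAt ℝ 2 m (x₀, x₀)) (hc : ContDiffAt ℝ 2 c (x₀, x₀))
    (hml : ∀ᶠ x in 𝓝 x₀, m (x, x₀) = x) (hmr : ∀ᶠ y in 𝓝 x₀, m (x₀, y) = y)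
    (hcr : ∀ᶠ x in 𝓝 x₀, c (x, x₀) = x₀)
    (hmc : ∀ᶠ p in 𝓝 ((x₀, x₀) : E × E), m (c p, p.1) = m p) (Y : E) :
    ∃ A : E →L[ℝ] E, HasFDerivAt (fun x => fderiv ℝ c (x, x₀) (0, Y)) A x₀ ∧
      ∀ X, A X = fderiv ℝ (fun x => fderiv ℝ m (x, x₀) (0, Y)) x₀ X
        - fderiv ℝ (fun x => fderiv ℝ m (x, x₀) (0, X)) x₀ Y := by
  have hm1 : DifferentiableAt ℝ (fderiv ℝ m) (x₀, x₀) :=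
    (hm.fderiv_right (m := 1) (by norm_num)).differentiableAt (by norm_num)
  have hc1 : DifferentiableAt ℝ (fderiv ℝ c) (x₀, x₀) :=
    (hc.fderiv_right (m := 1) (by norm_num)).differentiableAt (by norm_num)
  set M := fderiv ℝ (fderiv ℝ m) (x₀, x₀) with hM
  have hl : HasFDerivAt (fun x : E => (x, x₀)) (ContinuousLinearMap.inl ℝ E E) x₀ :=
    hasFDerivAt_prodMk_left x₀ x₀
  have hr : HasFDerivAt (fun x : E => (x₀, x)) (ContinuousLinearMap.inr ℝ E E) x₀ :=
    hasFDerivAt_prodMk_right x₀ x₀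
  have hml1 : HasFDerivAt (fun x => fderiv ℝ m (x, x₀)) (M.comp (.inl ℝ E E)) x₀ :=
    HasFDerivAt.comp x₀ (g := fderiv ℝ m) hm1.hasFDerivAt hl
  have hmr1 : HasFDerivAt (fun x => fderiv ℝ m (x₀, x)) (M.comp (.inr ℝ E E)) x₀ :=
    HasFDerivAt.comp x₀ (g := fderiv ℝ m) hm1.hasFDerivAt hr
  have hcl1 : HasFDerivAt (fun x => fderiv ℝ c (x, x₀))
      ((fderiv ℝ (fderiv ℝ c) (x₀, x₀)).comp (.inl ℝ E E)) x₀ :=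
    HasFDerivAt.comp x₀ (g := fderiv ℝ c) hc1.hasFDerivAt hl
  have hD : ∀ Z X : E, fderiv ℝ (fun x => fderiv ℝ m (x, x₀) (0, Z)) x₀ X = M (X, 0) (0, Z) := by
    intro Z X
    rw [(hml1.clm_apply (hasFDerivAt_const (0, Z) x₀)).fderiv]
    simp
  have hdm : DifferentiableAt ℝ m (x₀, x₀) := hm.differentiableAt (by norm_num)
  have hdl : ∀ Z, fderiv ℝ m (x₀, x₀) (Z, 0) = Z := by
    intro Z
    have h1 : HasFDerivAt (fun x => m (x, x₀)) ((fderiv ℝ m (x₀, x₀)).comp (.inl ℝ E E)) x₀ :=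
      HasFDerivAt.comp x₀ (g := m) hdm.hasFDerivAt hl
    have h2 := (hasFDerivAt_id (𝕜 := ℝ) x₀).congr_of_eventuallyEq (f₁ := fun x => m (x, x₀)) hml
    simpa using DFunLike.congr_fun (h1.unique h2) Z
  have hdr : ∀ Z, fderiv ℝ m (x₀, x₀) (0, Z) = Z := by
    intro Z
    have h1 : HasFDerivAt (fun x => m (x₀, x)) ((fderiv ℝ m (x₀, x₀)).comp (.inr ℝ E E)) x₀ :=
      HasFDerivAt.comp x₀ (g := m) hdm.hasFDerivAt hr
    have h2 := (hasFDerivAt_id (𝕜 := ℝ) x₀).congr_of_eventuallyEq (f₁ := fun x => m (x₀, x)) hmr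
    simpa using DFunLike.congr_fun (h1.unique h2) Z
  have hA := hcl1.clm_apply (hasFDerivAt_const ((0 : E), Y) x₀)
  set A := (ContinuousLinearMap.apply ℝ E ((0 : E), Y)).comp
    ((fderiv ℝ (fderiv ℝ c) (x₀, x₀)).comp (.inl ℝ E E)) with hAdef
  have hA' : HasFDerivAt (fun x => fderiv ℝ c (x, x₀) (0, Y)) A x₀ := by
    convert hA using 1
    ext X
    simp [hAdef]
  -- the first order identity near `x₀`
  have hmd : ∀ᶠ p in 𝓝 ((x₀, x₀) : E × E), DifferentiableAt ℝ m p := by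
    filter_upwards [hm.eventually (by simp)] with p hp using hp.differentiableAt (by norm_num)
  have hcd : ∀ᶠ p in 𝓝 ((x₀, x₀) : E × E), DifferentiableAt ℝ c p := by
    filter_upwards [hc.eventually (by simp)] with p hp using hp.differentiableAt (by norm_num)
  have hev : ∀ᶠ x in 𝓝 x₀, fderiv ℝ m (x₀, x) (fderiv ℝ c (x, x₀) (0, Y), 0)
      = fderiv ℝ m (x, x₀) (0, Y) := by
    have t1 : Filter.Tendsto (fun x : E => (x, x₀)) (𝓝 x₀) (𝓝 (x₀, x₀)) := hl.continuousAt
    have t2 : Filter.Tendsto (fun x : E => (x₀, x)) (𝓝 x₀) (𝓝 (x₀, x₀)) := hr.continuousAt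
    filter_upwards [hcr, t1.eventually hmd, t1.eventually hcd, t2.eventually hmd,
      t1.eventually hmc.eventually_nhds] with x h1 h2 h3 h4 h5
    have e1 : HasFDerivAt (fun y => m (x, y)) ((fderiv ℝ m (x, x₀)).comp (.inr ℝ E E)) x₀ :=
      HasFDerivAt.comp x₀ (g := m) h2.hasFDerivAt (hasFDerivAt_prodMk_right x x₀)
    have e2 : HasFDerivAt (fun y => c (x, y)) ((fderiv ℝ c (x, x₀)).comp (.inr ℝ E E)) x₀ :=
      HasFDerivAt.comp x₀ (g := c) h3.hasFDerivAt (hasFDerivAt_prodMk_right x x₀)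
    have e3 : HasFDerivAt (fun y => (c (x, y), x))
        (((fderiv ℝ c (x, x₀)).comp (.inr ℝ E E)).prod 0) x₀ :=
      e2.prodMk (hasFDerivAt_const x x₀)
    have e4 : HasFDerivAt (fun y => m (c (x, y), x)) ((fderiv ℝ m (x₀, x)).comp
        (((fderiv ℝ c (x, x₀)).comp (.inr ℝ E E)).prod 0)) x₀ := by
      refine HasFDerivAt.comp x₀ (g := m) ?_ e3
      rw [h1]
      exact h4.hasFDerivAt
    have e5 : (fun y => m (c (x, y), x)) =ᶠ[𝓝 x₀] fun y => m (x, y) :=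
      (hasFDerivAt_prodMk_right (𝕜 := ℝ) x x₀).continuousAt.eventually h5
    simpa using DFunLike.congr_fun (e4.unique (e1.congr_of_eventuallyEq e5)) Y
  refine ⟨A, hA', fun X => ?_⟩
  have hcY : fderiv ℝ c (x₀, x₀) (0, Y) = Y := by
    have := hev.self_of_nhds
    rwa [hdl, hdr] at this
  have hpair : HasFDerivAt (fun x => (fderiv ℝ c (x, x₀) (0, Y), (0 : E))) (A.prod 0) x₀ :=
    hA'.prodMk (hasFDerivAt_const 0 x₀)
  -- Differentiating the first order identity at `x₀` in direction `X` gives `M (0, X) (Y, 0) + A X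
  -- = M (X, 0) (0, Y)`; symmetry of the second derivative `M` turns this into the claim.
  have h1 := hmr1.clm_apply hpair
  have h2 := hml1.clm_apply (hasFDerivAt_const ((0 : E), Y) x₀)
  have h3 := DFunLike.congr_fun (h1.unique (h2.congr_of_eventuallyEq hev)) X
  have hsymm : M (0, X) (Y, 0) = M (Y, 0) (0, X) :=
    (hm.isSymmSndFDerivAt (by simp)) (0, X) (Y, 0)
  simp only [add_apply, ContinuousLinearMap.comp_apply,
    ContinuousLinearMap.prod_apply, zero_apply, hdl, hcY,
    ContinuousLinearMap.flip_apply, ContinuousLinearMap.inr_apply,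
    ContinuousLinearMap.inl_apply, map_zero, zero_add] at h3
  rw [hD, hD, ← hsymm]
  exact eq_sub_of_add_eq h3

/-- Uniqueness of solutions of autonomous differential equations with `C¹` right hand side. -/
theorem eqOn_Ioo_of_hasDerivAt_of_contDiff [CompleteSpace E] {F : E → E} (hF : ContDiff ℝ 1 F)
    {u v : ℝ → E} {a b t₀ : ℝ} (ht₀ : t₀ ∈ Set.Ioo a b)
    (hu : ∀ s ∈ Set.Ioo a b, HasDerivAt u (F (u s)) s)
    (hv : ∀ s ∈ Set.Ioo a b, HasDerivAt v (F (v s)) s) (h : u t₀ = v t₀) :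
    Set.EqOn u v (Set.Ioo a b) := by
  -- Solutions are integral curves of `F` on `E` regarded as a boundaryless manifold, where
  -- uniqueness on intervals applies.
  have key : ∀ w : ℝ → E, (∀ s ∈ Set.Ioo a b, HasDerivAt w (F (w s)) s) →
      IsMIntegralCurveOn (I := 𝓘(ℝ, E)) w F (Set.Ioo a b) := fun w hw s hs =>
    (hasMFDerivWithinAt_iff_hasFDerivWithinAt.2 (hw s hs).hasFDerivAt.hasFDerivWithinAt)
  refine isMIntegralCurveOn_Ioo_eqOn_of_contMDiff_boundaryless (I := 𝓘(ℝ, E)) (v := F) ht₀ ?_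
    (key u hu) (key v hv) h
  exact (contMDiff_vectorSpace_iff_contDiff (V := F)).2 hF

end Calculus

/-! ### Manifold derivatives in charts -/

section MFDeriv

variable {E : Type*} [NormedAddCommGroup E] [NormedSpace ℝ E]
  {M : Type*} [TopologicalSpace M] [ChartedSpace E M]
  {F : Type*} [NormedAddCommGroup F] [NormedSpace ℝ F]
  {N : Type*} [TopologicalSpace N] [ChartedSpace F N]

theorem mfderiv_apply_eq_fderiv {f : M → N} {x : M}
    (h : MDifferentiableAt 𝓘(ℝ, E) 𝓘(ℝ, F) f x) (v : E) :
    (mfderiv 𝓘(ℝ, E) 𝓘(ℝ, F) f x : E →L[ℝ] F) v =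
      fderiv ℝ (writtenInExtChartAt 𝓘(ℝ, E) 𝓘(ℝ, F) x f) (extChartAt 𝓘(ℝ, E) x x) v := by
  have h1 : fderivWithin ℝ (writtenInExtChartAt 𝓘(ℝ, E) 𝓘(ℝ, F) x f) (Set.range 𝓘(ℝ, E))
      (extChartAt 𝓘(ℝ, E) x x) =
      fderiv ℝ (writtenInExtChartAt 𝓘(ℝ, E) 𝓘(ℝ, F) x f) (extChartAt 𝓘(ℝ, E) x x) := by
    rw [modelWithCornersSelf_coe, Set.range_id, fderivWithin_univ]
  rw [← h1]
  exact DFunLike.congr_fun h.mfderiv v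

end MFDeriv

/-! ### Multiplication, conjugation and the Lie bracket in the chart at the identity -/

section ChartAtOne

variable {E : Type*} [NormedAddCommGroup E] [NormedSpace ℝ E]
  {G : Type*} [TopologicalSpace G] [ChartedSpace E G] [Group G]

variable (E G) in
/-- The preferred chart at the identity. -/
abbrev chartOne : PartialEquiv G E := extChartAt 𝓘(ℝ, E) (1 : G)

variable (E G) in
/-- The multiplication, read in the chart at the identity. -/
def chartMul (p : E × E) : E :=
  chartOne E G ((chartOne E G).symm p.1 * (chartOne E G).symm p.2)

variable (E G) in
/-- The conjugation `(g, h) ↦ g h g⁻¹`, read in the chart at the identity. -/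
def chartConj (p : E × E) : E :=
  chartOne E G ((chartOne E G).symm p.1 * (chartOne E G).symm p.2 * ((chartOne E G).symm p.1)⁻¹)

variable (G) in
theorem chartOne_symm_one : (chartOne E G).symm (chartOne E G 1) = 1 := extChartAt_to_inv (1 : G)

theorem chartOne_source_mem : (chartOne E G).source ∈ 𝓝 (1 : G) := extChartAt_source_mem_nhds 1

variable (G) in
theorem chartOne_target_mem : (chartOne E G).target ∈ 𝓝 (chartOne E G 1) :=
  extChartAt_target_mem_nhds 1

theorem chartMul_left {x : E} (hx : x ∈ (chartOne E G).target) :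
    chartMul E G (x, chartOne E G 1) = x := by
  simp only [chartMul, chartOne_symm_one, mul_one]
  exact (chartOne E G).right_inv hx

theorem chartMul_right {x : E} (hx : x ∈ (chartOne E G).target) :
    chartMul E G (chartOne E G 1, x) = x := by
  simp only [chartMul, chartOne_symm_one, one_mul]
  exact (chartOne E G).right_inv hx

theorem chartConj_right (x : E) : chartConj E G (x, chartOne E G 1) = chartOne E G 1 := by
  simp only [chartConj, chartOne_symm_one, mul_one, mul_inv_cancel]

variable [LieGroup 𝓘(ℝ, E) ∞ G]

variable (E G) in
theorem contMDiffAt_chartOne_symm :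
    ContMDiffAt 𝓘(ℝ, E) 𝓘(ℝ, E) ∞ (chartOne E G).symm (chartOne E G 1) :=
  (contMDiffOn_extChartAt_symm (1 : G)).contMDiffAt (chartOne_target_mem G)

variable (E G) in
theorem contDiffAt_chartMul :
    ContDiffAt ℝ ∞ (chartMul E G) (chartOne E G 1, chartOne E G 1) := by
  rw [← contMDiffAt_iff_contDiffAt]
  have h := contMDiffAt_chartOne_symm E G
  have h1 : ContMDiffAt 𝓘(ℝ, E × E) 𝓘(ℝ, E) ∞ (fun p : E × E => (chartOne E G).symm p.1)
      (chartOne E G 1, chartOne E G 1) :=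
    ContMDiffAt.comp (g := (chartOne E G).symm) _ h contDiff_fst.contMDiff.contMDiffAt
  have h2 : ContMDiffAt 𝓘(ℝ, E × E) 𝓘(ℝ, E) ∞ (fun p : E × E => (chartOne E G).symm p.2)
      (chartOne E G 1, chartOne E G 1) :=
    ContMDiffAt.comp (g := (chartOne E G).symm) _ h contDiff_snd.contMDiff.contMDiffAt
  refine ContMDiffAt.comp (g := chartOne E G) _ ?_ (h1.mul h2)
  simp only [chartOne_symm_one, mul_one]
  exact contMDiffAt_extChartAt

variable (E G) in
theorem contDiffAt_chartConj :
    ContDiffAt ℝ ∞ (chartConj E G) (chartOne E G 1, chartOne E G 1) := by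
  rw [← contMDiffAt_iff_contDiffAt]
  have h := contMDiffAt_chartOne_symm E G
  have h1 : ContMDiffAt 𝓘(ℝ, E × E) 𝓘(ℝ, E) ∞ (fun p : E × E => (chartOne E G).symm p.1)
      (chartOne E G 1, chartOne E G 1) :=
    ContMDiffAt.comp (g := (chartOne E G).symm) _ h contDiff_fst.contMDiff.contMDiffAt
  have h2 : ContMDiffAt 𝓘(ℝ, E × E) 𝓘(ℝ, E) ∞ (fun p : E × E => (chartOne E G).symm p.2)
      (chartOne E G 1, chartOne E G 1) :=
    ContMDiffAt.comp (g := (chartOne E G).symm) _ h contDiff_snd.contMDiff.contMDiffAt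
  refine ContMDiffAt.comp (g := chartOne E G) _ ?_ ((h1.mul h2).mul h1.inv)
  simp only [chartOne_symm_one, mul_one, inv_one]
  exact contMDiffAt_extChartAt

-- This is `(x y x⁻¹) x = x y`. It is local because the conjugate has to lie in the domain of the
-- chart.
variable (E G) in
theorem chartMul_chartConj :
    ∀ᶠ p in 𝓝 (chartOne E G 1, chartOne E G 1),
      chartMul E G (chartConj E G p, p.1) = chartMul E G p := by
  have h : ContinuousAt (chartOne E G).symm (chartOne E G 1) :=
    (contMDiffAt_chartOne_symm E G).continuousAt
  have h1 : ContinuousAt (fun p : E × E => (chartOne E G).symm p.1)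
      (chartOne E G 1, chartOne E G 1) :=
    ContinuousAt.comp (g := (chartOne E G).symm) h continuous_fst.continuousAt
  have h2 : ContinuousAt (fun p : E × E => (chartOne E G).symm p.2)
      (chartOne E G 1, chartOne E G 1) :=
    ContinuousAt.comp (g := (chartOne E G).symm) h continuous_snd.continuousAt
  have : IsTopologicalGroup G := topologicalGroup_of_lieGroup 𝓘(ℝ, E) ∞
  have h3 : ContinuousAt (fun p : E × E => (chartOne E G).symm p.1 * (chartOne E G).symm p.2 *
      ((chartOne E G).symm p.1)⁻¹) (chartOne E G 1, chartOne E G 1) := (h1.mul h2).mul h1.inv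
  have h4 := h3.preimage_mem_nhds (t := (chartOne E G).source)
    (by simpa only [chartOne_symm_one, mul_one, inv_one] using chartOne_source_mem)
  filter_upwards [h4] with p hp
  simp only [chartMul, chartConj]
  rw [(chartOne E G).left_inv hp, inv_mul_cancel_right]

-- Both partial derivatives are the identity, since the base point represents the unit.
variable (E G) in
theorem fderiv_chartMul_one (v w : E) :
    fderiv ℝ (chartMul E G) (chartOne E G 1, chartOne E G 1) (v, w) = v + w := by
  set x₀ : E := chartOne E G 1
  have hd : DifferentiableAt ℝ (chartMul E G) (x₀, x₀) :=
    (contDiffAt_chartMul E G).differentiableAt (by simp)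
  have h1 : HasFDerivAt (fun x => chartMul E G (x, x₀))
      ((fderiv ℝ (chartMul E G) (x₀, x₀)).comp (.inl ℝ E E)) x₀ :=
    HasFDerivAt.comp x₀ (g := chartMul E G) hd.hasFDerivAt (hasFDerivAt_prodMk_left x₀ x₀)
  have h2 : HasFDerivAt (fun x => chartMul E G (x₀, x))
      ((fderiv ℝ (chartMul E G) (x₀, x₀)).comp (.inr ℝ E E)) x₀ :=
    HasFDerivAt.comp x₀ (g := chartMul E G) hd.hasFDerivAt (hasFDerivAt_prodMk_right x₀ x₀)
  have e1 := DFunLike.congr_fun (h1.unique ((hasFDerivAt_id x₀).congr_of_eventuallyEq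
    (Filter.mem_of_superset (chartOne_target_mem G) fun x hx => chartMul_left hx))) v
  have e2 := DFunLike.congr_fun (h2.unique ((hasFDerivAt_id x₀).congr_of_eventuallyEq
    (Filter.mem_of_superset (chartOne_target_mem G) fun x hx => chartMul_right hx))) w
  simp only [ContinuousLinearMap.comp_apply, ContinuousLinearMap.inl_apply,
    ContinuousLinearMap.inr_apply, ContinuousLinearMap.id_apply] at e1 e2
  calc _ = fderiv ℝ (chartMul E G) (x₀, x₀) ((v, 0) + (0, w)) := by simp
    _ = v + w := by rw [map_add, e1, e2]

theorem mdifferentiable_conj (g : G) :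
    MDifferentiable 𝓘(ℝ, E) 𝓘(ℝ, E) (fun h : G => g * h * g⁻¹) := by
  have h : ContMDiff 𝓘(ℝ, E) 𝓘(ℝ, E) ∞ (fun h : G => g * h * g⁻¹) :=
    (contMDiff_const.mul contMDiff_id).mul contMDiff_const
  exact h.mdifferentiable (by simp)

theorem Ad_apply_eq_fderiv (g : G) (Y : LieAlg E G) :
    (Ad g Y : E) = fderiv ℝ (fun y : E => chartOne E G (g * (chartOne E G).symm y * g⁻¹))
      (chartOne E G 1) Y := by
  have h := mdifferentiable_conj (E := E) g (1 : G)
  have h1 : g * 1 * g⁻¹ = 1 := by group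
  have h2 : writtenInExtChartAt 𝓘(ℝ, E) 𝓘(ℝ, E) (1 : G) (fun h : G => g * h * g⁻¹)
      = fun y : E => chartOne E G (g * (chartOne E G).symm y * g⁻¹) := by
    funext y
    simp only [writtenInExtChartAt, Function.comp_apply, h1]
  rw [← h2]
  exact mfderiv_apply_eq_fderiv h Y

/-- For `g` in the chart domain, `Ad g Y` becomes a partial derivative of one smooth function of two
variables, and can therefore be differentiated in `g`. -/
theorem eventually_Ad_eq (Y : LieAlg E G) :
    ∀ᶠ g in 𝓝 (1 : G), (Ad g Y : E) =
      fderiv ℝ (chartConj E G) (chartOne E G g, chartOne E G 1) (0, Y) := by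
  have hc : ∀ᶠ p in 𝓝 (chartOne E G 1, chartOne E G 1),
      DifferentiableAt ℝ (chartConj E G) p := by
    have h := (contDiffAt_chartConj E G).of_le (m := 1) (by simp)
    filter_upwards [h.eventually (by simp)] with p hp using hp.differentiableAt (by simp)
  have ht : Filter.Tendsto (fun g : G => (chartOne E G g, chartOne E G 1)) (𝓝 1)
      (𝓝 (chartOne E G 1, chartOne E G 1)) :=
    (continuousAt_extChartAt (1 : G)).prodMk continuousAt_const
  filter_upwards [ht.eventually hc, chartOne_source_mem (E := E)] with g hg hs
  have e2 : HasFDerivAt (fun y => chartConj E G (chartOne E G g, y))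
      ((fderiv ℝ (chartConj E G) (chartOne E G g, chartOne E G 1)).comp (.inr ℝ E E))
      (chartOne E G 1) :=
    HasFDerivAt.comp (chartOne E G 1) (g := chartConj E G) hg.hasFDerivAt
      (hasFDerivAt_prodMk_right (chartOne E G g) (chartOne E G 1))
  have e3 : (fun y => chartConj E G (chartOne E G g, y))
      = fun y : E => chartOne E G (g * (chartOne E G).symm y * g⁻¹) := by
    funext y
    simp only [chartConj]
    rw [(chartOne E G).left_inv hs]
  rw [Ad_apply_eq_fderiv, ← e3, e2.fderiv]
  rfl

/-- The left invariant field at `g` is the derivative of `h ↦ g h` at `1`; the chart turns it into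
the derivative of the multiplication in its second variable. The bracket is defined through these
pullbacks. -/
theorem mpullback_mulInvariantVectorField_chart (Y : LieAlg E G) :
    ∀ᶠ x in 𝓝 (chartOne E G 1),
      (VectorField.mpullbackWithin 𝓘(ℝ, E) 𝓘(ℝ, E) (chartOne E G).symm
        (mulInvariantVectorField (I := 𝓘(ℝ, E)) Y) (Set.range 𝓘(ℝ, E)) x : E) =
      fderiv ℝ (chartMul E G) (x, chartOne E G 1) (0, Y) := by
  have hm : ∀ᶠ p in 𝓝 (chartOne E G 1, chartOne E G 1),
      DifferentiableAt ℝ (chartMul E G) p := by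
    have h := (contDiffAt_chartMul E G).of_le (m := 1) (by simp)
    filter_upwards [h.eventually (by simp)] with p hp using hp.differentiableAt (by simp)
  have ht : Filter.Tendsto (fun x : E => (x, chartOne E G 1)) (𝓝 (chartOne E G 1))
      (𝓝 (chartOne E G 1, chartOne E G 1)) :=
    continuousAt_id.prodMk continuousAt_const
  filter_upwards [ht.eventually hm, chartOne_target_mem G] with x hx hxt
  set g : G := (chartOne E G).symm x with hg
  have hgs : g ∈ (chartOne E G).source := (chartOne E G).map_target hxt
  have hman : IsManifold 𝓘(ℝ, E) 1 G := inferInstance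
  have hinv : (mfderivWithin 𝓘(ℝ, E) 𝓘(ℝ, E) (chartOne E G).symm (Set.range 𝓘(ℝ, E)) x).inverse
      = mfderiv 𝓘(ℝ, E) 𝓘(ℝ, E) (chartOne E G) g :=
    ContinuousLinearMap.inverse_eq
      (mfderivWithin_extChartAt_symm_comp_mfderiv_extChartAt hxt)
      (mfderiv_extChartAt_comp_mfderivWithin_extChartAt_symm hxt)
  have hL : MDifferentiableAt 𝓘(ℝ, E) 𝓘(ℝ, E) (fun h : G => g * h) 1 :=
    (contMDiff_mul_left (I := 𝓘(ℝ, E)) (n := ∞)).mdifferentiable (by simp) 1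
  have hg1 : g * 1 = g := mul_one g
  have hE : MDifferentiableAt 𝓘(ℝ, E) 𝓘(ℝ, E) (chartOne E G) (g * 1) := by
    rw [hg1]
    exact mdifferentiableAt_extChartAt (by rwa [← extChartAt_source 𝓘(ℝ, E)])
  have hcomp := mfderiv_comp (1 : G) hE hL
  have hcd : MDifferentiableAt 𝓘(ℝ, E) 𝓘(ℝ, E) (chartOne E G ∘ fun h : G => g * h) 1 :=
    hE.comp (1 : G) hL
  have hw : writtenInExtChartAt 𝓘(ℝ, E) 𝓘(ℝ, E) (1 : G) (chartOne E G ∘ fun h : G => g * h)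
      = fun y => chartMul E G (x, y) := by
    funext y
    simp only [writtenInExtChartAt, Function.comp_apply, chartMul, extChartAt_model_space_eq_id]
    rfl
  have e2 : HasFDerivAt (fun y => chartMul E G (x, y))
      ((fderiv ℝ (chartMul E G) (x, chartOne E G 1)).comp (.inr ℝ E E)) (chartOne E G 1) :=
    HasFDerivAt.comp (chartOne E G 1) (g := chartMul E G) hx.hasFDerivAt
      (hasFDerivAt_prodMk_right x (chartOne E G 1))
  have h5 := mfderiv_apply_eq_fderiv hcd Y
  rw [hw] at h5
  have h6 : fderiv ℝ (fun y => chartMul E G (x, y)) (chartOne E G 1) Y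
      = fderiv ℝ (chartMul E G) (x, chartOne E G 1) (0, Y) := by
    rw [e2.fderiv]
    rfl
  rw [VectorField.mpullbackWithin_apply]
  rw [hinv]
  have h3 := DFunLike.congr_fun hcomp Y
  -- `g * 1` and `g` agree only propositionally, so the derivative of the chart is carried from one
  -- to the other by substitution.
  have h4 : ∀ g' : G, g' = g → ∀ v : E,
      (mfderiv 𝓘(ℝ, E) 𝓘(ℝ, E) (chartOne E G) g' : E →L[ℝ] E) v
        = (mfderiv 𝓘(ℝ, E) 𝓘(ℝ, E) (chartOne E G) g : E →L[ℝ] E) v := by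
    rintro _ rfl v
    rfl
  exact ((h4 _ hg1 _).symm.trans h3.symm).trans (h5.trans h6)

/-- The derivative of the chart at its own base point is the identity, so the bracket is that of the
coordinate fields, whose values at the base point are `X` and `Y`. -/
theorem bracket_eq_fderiv_chartMul (X Y : LieAlg E G) :
    ((⁅X, Y⁆ : LieAlg E G) : E) =
      fderiv ℝ (fun x => fderiv ℝ (chartMul E G) (x, chartOne E G 1) (0, Y)) (chartOne E G 1) X
      - fderiv ℝ (fun x => fderiv ℝ (chartMul E G) (x, chartOne E G 1) (0, X))
        (chartOne E G 1) Y := by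
  have hman : IsManifold 𝓘(ℝ, E) 1 G := inferInstance
  have h0 : (mfderiv 𝓘(ℝ, E) 𝓘(ℝ, E) (chartOne E G) (1 : G) : E →L[ℝ] E)
      = ContinuousLinearMap.id ℝ E := mfderiv_extChartAt_self
  have h1 : ∀ w : E, (mfderiv 𝓘(ℝ, E) 𝓘(ℝ, E) (chartOne E G) (1 : G) : E →L[ℝ] E).inverse w
      = w := fun w =>
    (congrArg (fun A : E →L[ℝ] E => A.inverse w) h0).trans
      (by simp only [ContinuousLinearMap.inverse_id, ContinuousLinearMap.id_apply])
  have key : ∀ (x y : E) (V W : E → E) (s : Set E), s = Set.univ →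
      (V =ᶠ[𝓝 (chartOne E G 1)] fun z => fderiv ℝ (chartMul E G) (z, chartOne E G 1) (0, x)) →
      (W =ᶠ[𝓝 (chartOne E G 1)] fun z => fderiv ℝ (chartMul E G) (z, chartOne E G 1) (0, y)) →
      VectorField.lieBracketWithin ℝ V W s (chartOne E G 1) =
      fderiv ℝ (fun z => fderiv ℝ (chartMul E G) (z, chartOne E G 1) (0, y)) (chartOne E G 1) x
      - fderiv ℝ (fun z => fderiv ℝ (chartMul E G) (z, chartOne E G 1) (0, x))
        (chartOne E G 1) y := by
    rintro x y V W _ rfl hV hW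
    rw [VectorField.lieBracketWithin_univ, hV.lieBracket_vectorField_eq hW,
      VectorField.lieBracket, fderiv_chartMul_one, fderiv_chartMul_one, zero_add, zero_add]
  refine (h1 _).trans (key _ _ _ _ _ ?_ (mpullback_mulInvariantVectorField_chart X)
    (mpullback_mulInvariantVectorField_chart Y))
  simp only [Set.preimage_univ, Set.univ_inter, modelWithCornersSelf_coe, Set.range_id]

end ChartAtOne

/-! ### Velocities of curves at the identity and the adjoint representation -/

section CurvesAtOne

variable {E : Type*} [NormedAddCommGroup E] [NormedSpace ℝ E]
  {G : Type*} [TopologicalSpace G] [ChartedSpace E G] [Group G]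

/-- The curve `γ` passes through the identity at time `t₀`, with velocity `ξ`. -/
def HasVelocityAtOne (γ : ℝ → G) (ξ : LieAlg E G) (t₀ : ℝ) : Prop :=
  γ t₀ = 1 ∧ ContinuousAt γ t₀ ∧ HasDerivAt (fun t => chartOne E G (γ t)) (ξ : E) t₀

theorem HasVelocityAtOne.unique {γ : ℝ → G} {ξ η : LieAlg E G} {t₀ : ℝ}
    (h : HasVelocityAtOne γ ξ t₀) (h' : HasVelocityAtOne γ η t₀) : ξ = η :=
  h.2.2.unique h'.2.2

theorem HasVelocityAtOne.comp_affine {γ : ℝ → G} {ξ : LieAlg E G} {t₀ : ℝ}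
    (h : HasVelocityAtOne γ ξ t₀) (a b : ℝ) {s₀ : ℝ} (hs : a * s₀ + b = t₀) :
    HasVelocityAtOne (fun s => γ (a * s + b)) (a • ξ) s₀ := by
  subst hs
  have hd : HasDerivAt (fun s : ℝ => a * s + b) a s₀ := by
    simpa using ((hasDerivAt_id s₀).const_mul a).add_const b
  exact ⟨h.1, ContinuousAt.comp (g := γ) h.2.1 hd.continuousAt,
    HasDerivAt.scomp (h := fun s : ℝ => a * s + b) s₀ h.2.2 hd⟩

/-- Since `γ t₀ = 1`, the preferred chart at `γ t₀` is the chart at the identity. -/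
theorem hasVelocityAtOne_iff {γ : ℝ → G} {ξ : LieAlg E G} {t₀ : ℝ} :
    HasVelocityAtOne γ ξ t₀ ↔ γ t₀ = 1 ∧
      HasMFDerivAt 𝓘(ℝ, ℝ) 𝓘(ℝ, E) γ t₀ (ContinuousLinearMap.toSpanSingleton ℝ (ξ : E)) := by
  refine and_congr_right fun h => and_congr_right fun _ => ?_
  have hw : writtenInExtChartAt 𝓘(ℝ, ℝ) 𝓘(ℝ, E) t₀ γ = fun t => chartOne E G (γ t) := by
    funext t
    simp only [writtenInExtChartAt, Function.comp_apply, h, extChartAt_model_space_eq_id]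
    rfl
  have key : ∀ x : E, HasDerivAt (fun t => chartOne E G (γ t)) x t₀ ↔
      HasFDerivWithinAt (fun t => chartOne E G (γ t)) (ContinuousLinearMap.toSpanSingleton ℝ x)
        Set.univ t₀ := fun x => by
    rw [hasFDerivWithinAt_univ, hasDerivAt_iff_hasFDerivAt]
  rw [hw, modelWithCornersSelf_coe, Set.range_id]
  exact key ξ

theorem exists_hasVelocityAtOne_of_mdifferentiableAt {γ : ℝ → G} {t₀ : ℝ} (h1 : γ t₀ = 1)
    (h : MDifferentiableAt 𝓘(ℝ, ℝ) 𝓘(ℝ, E) γ t₀) :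
    ∃ ξ : LieAlg E G, HasVelocityAtOne γ ξ t₀ := by
  refine ⟨(mfderiv 𝓘(ℝ, ℝ) 𝓘(ℝ, E) γ t₀ : ℝ →L[ℝ] E) 1, hasVelocityAtOne_iff.2 ⟨h1, ?_⟩⟩
  have h2 := h.hasMFDerivAt
  have h3 : ContinuousLinearMap.toSpanSingleton ℝ
      ((mfderiv 𝓘(ℝ, ℝ) 𝓘(ℝ, E) γ t₀ : ℝ →L[ℝ] E) 1) = mfderiv 𝓘(ℝ, ℝ) 𝓘(ℝ, E) γ t₀ :=
    ContinuousLinearMap.ext_ring (one_smul ℝ _)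
  rw [h3]
  exact h2

/-- Every element of the Lie algebra is the velocity of a curve. -/
theorem exists_hasVelocityAtOne [LieGroup 𝓘(ℝ, E) ∞ G] (ξ : LieAlg E G) (t₀ : ℝ) :
    ∃ γ : ℝ → G, HasVelocityAtOne γ ξ t₀ := by
  suffices H : ∀ x : E, ∃ γ : ℝ → G, γ t₀ = 1 ∧ ContinuousAt γ t₀ ∧
      HasDerivAt (fun t => chartOne E G (γ t)) x t₀ from H ξ
  intro x
  have hd : HasDerivAt (fun t : ℝ => chartOne E G 1 + (t - t₀) • x) x t₀ := by
    simpa using (((hasDerivAt_id t₀).sub_const t₀).smul_const x).const_add (chartOne E G 1)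
  have h0 : chartOne E G 1 + (t₀ - t₀) • x = chartOne E G 1 := by simp
  refine ⟨fun t => (chartOne E G).symm (chartOne E G 1 + (t - t₀) • x), ?_, ?_, ?_⟩
  · simp only [h0, chartOne_symm_one]
  · refine ContinuousAt.comp (g := (chartOne E G).symm) ?_ hd.continuousAt
    rw [h0]
    exact (contMDiffAt_chartOne_symm E G).continuousAt
  · refine hd.congr_of_eventuallyEq ?_
    have := hd.continuousAt.preimage_mem_nhds (t := (chartOne E G).target)
      (by rw [h0]; exact chartOne_target_mem G)
    filter_upwards [this] with t ht using (chartOne E G).right_inv ht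

variable {F : Type*} [NormedAddCommGroup F] [NormedSpace ℝ F]
  {K : Type*} [TopologicalSpace K] [ChartedSpace F K] [Group K]

theorem HasVelocityAtOne.comp_mfderiv {γ : ℝ → K} {ξ : LieAlg F K} {t₀ : ℝ}
    (h : HasVelocityAtOne γ ξ t₀) {f : K → G} (hf : MDifferentiableAt 𝓘(ℝ, F) 𝓘(ℝ, E) f 1)
    (hf1 : f 1 = 1) :
    HasVelocityAtOne (fun t => f (γ t))
      ((mfderiv 𝓘(ℝ, F) 𝓘(ℝ, E) f 1 : F →L[ℝ] E) ξ : E) t₀ := by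
  obtain ⟨h1, h2⟩ := hasVelocityAtOne_iff.1 h
  refine hasVelocityAtOne_iff.2 ⟨by rw [h1, hf1], ?_⟩
  have h3 : ∀ k : K, k = 1 → HasMFDerivAt 𝓘(ℝ, F) 𝓘(ℝ, E) f k
      (mfderiv 𝓘(ℝ, F) 𝓘(ℝ, E) f 1 : F →L[ℝ] E) := by
    rintro _ rfl
    exact hf.hasMFDerivAt
  have h4 := (h3 _ h1).comp t₀ h2
  have h5 : ContinuousLinearMap.toSpanSingleton ℝ
      ((mfderiv 𝓘(ℝ, F) 𝓘(ℝ, E) f 1 : F →L[ℝ] E) (ξ : F)) =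
      (mfderiv 𝓘(ℝ, F) 𝓘(ℝ, E) f 1 : F →L[ℝ] E).comp
        (ContinuousLinearMap.toSpanSingleton ℝ (ξ : F)) :=
    ContinuousLinearMap.ext_ring (by simp)
  exact Eq.mpr (congrArg (fun A : ℝ →L[ℝ] E =>
    HasMFDerivAt 𝓘(ℝ, ℝ) 𝓘(ℝ, E) (fun t => f (γ t)) t₀ A) h5) h4

theorem HasVelocityAtOne.map {γ : ℝ → K} {ξ : LieAlg F K} {t₀ : ℝ}
    (h : HasVelocityAtOne γ ξ t₀) (ι : K →* G) (hι : ContMDiff 𝓘(ℝ, F) 𝓘(ℝ, E) ∞ ι) :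
    HasVelocityAtOne (fun t => ι (γ t)) (differential (E := E) ι ξ) t₀ :=
  h.comp_mfderiv (hι.mdifferentiable (by simp) 1) (map_one ι)

variable [LieGroup 𝓘(ℝ, E) ∞ G] {γ δ : ℝ → G} {ξ η : LieAlg E G} {t₀ : ℝ}

theorem HasVelocityAtOne.conj (h : HasVelocityAtOne γ ξ t₀) (g : G) :
    HasVelocityAtOne (fun t => g * γ t * g⁻¹) (Ad g ξ) t₀ :=
  h.comp_mfderiv (mdifferentiable_conj g 1) (by group)

/-- The derivative of the multiplication at `(1, 1)` is addition. -/
theorem HasVelocityAtOne.mul (h : HasVelocityAtOne γ ξ t₀) (h' : HasVelocityAtOne δ η t₀) :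
    HasVelocityAtOne (fun t => γ t * δ t) (ξ + η) t₀ := by
  have : IsTopologicalGroup G := topologicalGroup_of_lieGroup 𝓘(ℝ, E) ∞
  refine ⟨by simp only [h.1, h'.1, one_mul], h.2.1.mul h'.2.1, ?_⟩
  have hd : HasFDerivAt (chartMul E G) (fderiv ℝ (chartMul E G) (chartOne E G 1, chartOne E G 1))
      (chartOne E G (γ t₀), chartOne E G (δ t₀)) := by
    rw [h.1, h'.1]
    exact ((contDiffAt_chartMul E G).differentiableAt (by simp)).hasFDerivAt
  have h1 : ∀ x y : E, HasDerivAt (fun t => chartOne E G (γ t)) x t₀ →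
      HasDerivAt (fun t => chartOne E G (δ t)) y t₀ → HasDerivAt (fun t => chartMul E G
        (chartOne E G (γ t), chartOne E G (δ t))) (x + y) t₀ := by
    intro x y hx hy
    rw [← fderiv_chartMul_one E G]
    exact HasFDerivAt.comp_hasDerivAt t₀ hd (hx.prodMk hy)
  refine (h1 _ _ h.2.2 h'.2.2).congr_of_eventuallyEq ?_
  filter_upwards [h.2.1.preimage_mem_nhds (t := (chartOne E G).source)
      (by rw [h.1]; exact chartOne_source_mem),
    h'.2.1.preimage_mem_nhds (t := (chartOne E G).source)
      (by rw [h'.1]; exact chartOne_source_mem)] with t ht ht'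
  simp only [chartMul]
  rw [(chartOne E G).left_inv ht, (chartOne E G).left_inv ht']

/-- Smoothness of inversion provides some velocity; the product rule for `γ γ⁻¹ = 1` identifies it.
-/
theorem HasVelocityAtOne.inv (h : HasVelocityAtOne γ ξ t₀) :
    HasVelocityAtOne (fun t => (γ t)⁻¹) (-ξ) t₀ := by
  have hi : MDifferentiableAt 𝓘(ℝ, E) 𝓘(ℝ, E) (fun g : G => g⁻¹) 1 :=
    (contMDiff_inv 𝓘(ℝ, E) ∞).mdifferentiable (by simp) 1
  have h1 := h.comp_mfderiv hi inv_one
  set ζ : LieAlg E G := ((mfderiv 𝓘(ℝ, E) 𝓘(ℝ, E) (fun g : G => g⁻¹) 1 : E →L[ℝ] E) ξ : E)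
  have h2 := h.mul h1
  simp only [mul_inv_cancel] at h2
  have h3 : HasVelocityAtOne (fun _ => (1 : G)) (0 : LieAlg E G) t₀ :=
    ⟨rfl, continuousAt_const, hasDerivAt_const _ _⟩
  rwa [← eq_neg_of_add_eq_zero_right (h2.unique h3)]

/-- Represent `X` as the velocity of a curve and compute the conjugated curve in two ways;
velocities are unique. `Ad_one` and `differential_Ad` follow the same pattern. -/
theorem Ad_mul (g h : G) (X : LieAlg E G) : Ad (g * h) X = Ad g (Ad h X) := by
  obtain ⟨γ, hγ⟩ := exists_hasVelocityAtOne X 0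
  refine (hγ.conj (g * h)).unique ?_
  convert (hγ.conj h).conj g using 2
  group

theorem Ad_one (X : LieAlg E G) : Ad (1 : G) X = X := by
  obtain ⟨γ, hγ⟩ := exists_hasVelocityAtOne X 0
  refine (hγ.conj 1).unique ?_
  simpa using hγ

theorem Ad_Ad_inv (g : G) (X : LieAlg E G) : Ad g (Ad g⁻¹ X) = X := by
  rw [← Ad_mul, mul_inv_cancel, Ad_one]

theorem differential_Ad [LieGroup 𝓘(ℝ, F) ∞ K] (ι : K →* G)
    (hι : ContMDiff 𝓘(ℝ, F) 𝓘(ℝ, E) ∞ ι) (k : K) (X : LieAlg F K) :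
    differential (E := E) ι (Ad k X) = Ad (ι k) (differential (E := E) ι X) := by
  obtain ⟨γ, hγ⟩ := exists_hasVelocityAtOne X 0
  refine ((hγ.conj k).map ι hι).unique ?_
  simpa only [map_mul, map_inv] using (hγ.map ι hι).conj (ι k)

/-- In the chart, the mixed second derivative of the conjugation and the bracket of left invariant
fields are the same antisymmetrization of the second derivative of the multiplication. -/
theorem HasVelocityAtOne.hasDerivAt_Ad (h : HasVelocityAtOne γ ξ t₀)
    (Y : LieAlg E G) :
    HasDerivAt (fun t => (Ad (γ t) Y : E)) (⁅ξ, Y⁆ : LieAlg E G) t₀ := by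
  have two_le : (2 : WithTop ℕ∞) ≤ ∞ :=
    (WithTop.coe_le_coe.2 le_top : ((2 : ℕ∞) : WithTop ℕ∞) ≤ ∞)
  obtain ⟨A, hA, hA'⟩ := hasFDerivAt_fderiv_conj
    ((contDiffAt_chartMul E G).of_le two_le) ((contDiffAt_chartConj E G).of_le two_le)
    (Filter.mem_of_superset (chartOne_target_mem G) fun x hx => chartMul_left hx)
    (Filter.mem_of_superset (chartOne_target_mem G) fun x hx => chartMul_right hx)
    (Filter.Eventually.of_forall fun x => chartConj_right x)
    (chartMul_chartConj E G) (Y : E)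
  have hA1 : HasFDerivAt (fun x => fderiv ℝ (chartConj E G) (x, chartOne E G 1) (0, Y)) A
      (chartOne E G (γ t₀)) := by
    rwa [h.1]
  have h1 := HasFDerivAt.comp_hasDerivAt t₀ hA1 h.2.2
  have h3 : (⁅ξ, Y⁆ : LieAlg E G) = A ξ :=
    (bracket_eq_fderiv_chartMul ξ Y).trans (hA' ξ).symm
  suffices H : ∀ x : E, x = A ξ → HasDerivAt (fun t => (Ad (γ t) Y : E)) x t₀ from H _ h3
  rintro _ rfl
  refine h1.congr_of_eventuallyEq ?_
  have h2 := h.2.1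
  rw [ContinuousAt, h.1] at h2
  exact h2.eventually (eventually_Ad_eq Y)

end CurvesAtOne

/-! ### One-parameter subgroups and the exponential map -/

section OneParameterSubgroups

variable {E : Type*} [NormedAddCommGroup E] [NormedSpace ℝ E]
  {G : Type*} [TopologicalSpace G] [ChartedSpace E G] [Group G]

theorem IsOneParam.mdifferentiable {X : LieAlg E G} {c : ℝ → G} (hc : IsOneParam X c) :
    MDifferentiable 𝓘(ℝ, ℝ) 𝓘(ℝ, E) c := fun t => (hc.2 t).mdifferentiableAt

theorem IsOneParam.smul {X : LieAlg E G} {c : ℝ → G} (hc : IsOneParam X c) (a : ℝ) :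
    IsOneParam (a • X) (fun t => c (t * a)) := by
  refine ⟨by simpa using hc.1, ?_⟩
  rw [mulInvariantVectorField_smul]
  exact hc.2.comp_mul a

theorem IsOneParam.hasVelocityAtOne {X : LieAlg E G} {c : ℝ → G} (hc : IsOneParam X c) :
    HasVelocityAtOne c X 0 := by
  refine hasVelocityAtOne_iff.2 ⟨hc.1, ?_⟩
  have h1 : (mulInvariantVectorField (I := 𝓘(ℝ, E)) X (c 0) : E) = X := by
    have h2 : ∀ g : G, g = 1 →
        (mfderiv 𝓘(ℝ, E) 𝓘(ℝ, E) (fun x : G => g * x) 1 : E →L[ℝ] E) X = X := by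
      rintro _ rfl
      have h3 : (fun x : G => 1 * x) = id := funext one_mul
      rw [h3]
      exact DFunLike.congr_fun (mfderiv_id (I := 𝓘(ℝ, E)) (x := (1 : G))) X
    exact h2 _ hc.1
  have h4 : ∀ x y : E, x = y → HasMFDerivAt 𝓘(ℝ, ℝ) 𝓘(ℝ, E) c 0
      ((1 : ℝ →L[ℝ] ℝ).smulRight x) → HasMFDerivAt 𝓘(ℝ, ℝ) 𝓘(ℝ, E) c 0
      (ContinuousLinearMap.toSpanSingleton ℝ y) := by
    rintro x _ rfl h
    have h5 : (1 : ℝ →L[ℝ] ℝ).smulRight x = ContinuousLinearMap.toSpanSingleton ℝ x :=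
      ContinuousLinearMap.ext_ring (by simp)
    exact Eq.mp (congrArg (fun A : ℝ →L[ℝ] E => HasMFDerivAt 𝓘(ℝ, ℝ) 𝓘(ℝ, E) c 0 A) h5) h
  exact h4 _ _ h1 (hc.2 0)

variable [LieGroup 𝓘(ℝ, E) ∞ G]

/-- Left invariance: the chain rule for `g (h x) = (g h) x` at `x = 1`. -/
theorem mfderiv_mul_left_mulInvariantVectorField (X : LieAlg E G) (g h : G) :
    (mfderiv 𝓘(ℝ, E) 𝓘(ℝ, E) (fun x : G => g * x) h : E →L[ℝ] E)
      (mulInvariantVectorField (I := 𝓘(ℝ, E)) X h : E) =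
      mulInvariantVectorField (I := 𝓘(ℝ, E)) X (g * h) := by
  have hL : ∀ a b : G, MDifferentiableAt 𝓘(ℝ, E) 𝓘(ℝ, E) (fun x : G => a * x) b := fun a b =>
    (contMDiff_mul_left (I := 𝓘(ℝ, E)) (n := ∞)).mdifferentiable (by simp) b
  have h1 := DFunLike.congr_fun (mfderiv_comp (1 : G) (hL g (h * 1)) (hL h 1)) X
  have h2 : ((fun x : G => g * x) ∘ fun x : G => h * x) = fun x : G => g * h * x := by
    funext x
    simp only [Function.comp_apply, mul_assoc]
  rw [h2] at h1
  have h3 : ∀ k : G, k = h → ∀ v : E,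
      (mfderiv 𝓘(ℝ, E) 𝓘(ℝ, E) (fun x : G => g * x) k : E →L[ℝ] E) v =
      (mfderiv 𝓘(ℝ, E) 𝓘(ℝ, E) (fun x : G => g * x) h : E →L[ℝ] E) v := by
    rintro _ rfl v
    rfl
  exact (h3 _ (mul_one h) _).symm.trans h1.symm

theorem IsMIntegralCurveOn.const_mul {X : LieAlg E G} {c : ℝ → G} {s : Set ℝ}
    (hc : IsMIntegralCurveOn c (mulInvariantVectorField (I := 𝓘(ℝ, E)) X) s) (g : G) :
    IsMIntegralCurveOn (fun t => g * c t) (mulInvariantVectorField (I := 𝓘(ℝ, E)) X) s := by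
  intro t ht
  have hL : HasMFDerivAt 𝓘(ℝ, E) 𝓘(ℝ, E) (fun x : G => g * x) (c t)
      (mfderiv 𝓘(ℝ, E) 𝓘(ℝ, E) (fun x : G => g * x) (c t)) :=
    ((contMDiff_mul_left (I := 𝓘(ℝ, E)) (n := ∞)).mdifferentiable (by simp) (c t)).hasMFDerivAt
  have h1 := hL.comp_hasMFDerivWithinAt t (hc t ht)
  have h2 : (mfderiv 𝓘(ℝ, E) 𝓘(ℝ, E) (fun x : G => g * x) (c t) : E →L[ℝ] E).comp
      ((1 : ℝ →L[ℝ] ℝ).smulRight (mulInvariantVectorField (I := 𝓘(ℝ, E)) X (c t) : E)) =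
      (1 : ℝ →L[ℝ] ℝ).smulRight (mulInvariantVectorField (I := 𝓘(ℝ, E)) X (g * c t) : E) := by
    rw [← mfderiv_mul_left_mulInvariantVectorField]
    exact ContinuousLinearMap.ext_ring (by simp)
  exact Eq.mp (congrArg (fun A : ℝ →L[ℝ] E =>
    HasMFDerivWithinAt 𝓘(ℝ, ℝ) 𝓘(ℝ, E) (fun t => g * c t) s t A) h2) h1

theorem IsMIntegralCurve.const_mul {X : LieAlg E G} {c : ℝ → G}
    (hc : IsMIntegralCurve c (mulInvariantVectorField (I := 𝓘(ℝ, E)) X)) (g : G) :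
    IsMIntegralCurve (fun t => g * c t) (mulInvariantVectorField (I := 𝓘(ℝ, E)) X) := by
  rw [isMIntegralCurve_iff_isMIntegralCurveOn] at hc ⊢
  exact IsMIntegralCurveOn.const_mul hc g

theorem contMDiff_one_mulInvariantVectorField (X : LieAlg E G) :
    ContMDiff 𝓘(ℝ, E) 𝓘(ℝ, E).tangent 1
      (fun g : G => (⟨g, mulInvariantVectorField X g⟩ : TangentBundle 𝓘(ℝ, E) G)) :=
  (contMDiff_mulInvariantVectorField X).of_le (by simp)

variable [T2Space G]

/-- Left translates of a local integral curve through `1` start at every point and live for the same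
time `ε`. A field with such a uniform existence time is complete. -/
theorem exists_isOneParam [CompleteSpace E] (X : LieAlg E G) : ∃ c : ℝ → G, IsOneParam X c := by
  have hman : IsManifold 𝓘(ℝ, E) 1 G := inferInstance
  have hv := contMDiff_one_mulInvariantVectorField X
  obtain ⟨γ, h1, h2⟩ := exists_isMIntegralCurveAt_of_contMDiffAt_boundaryless 0
    (hv.contMDiffAt (x := (1 : G)))
  obtain ⟨ε, hε, h3⟩ := isMIntegralCurveAt_iff'.1 h2
  rw [Real.ball_eq_Ioo, zero_sub, zero_add] at h3
  exact exists_isMIntegralCurve_of_isMIntegralCurveOn hv hε (fun g =>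
    ⟨fun t => g * γ t, by simp only [h1, mul_one], IsMIntegralCurveOn.const_mul h3 g⟩) 1

theorem IsOneParam.unique {X : LieAlg E G} {c d : ℝ → G} (hc : IsOneParam X c)
    (hd : IsOneParam X d) : c = d := by
  have hman : IsManifold 𝓘(ℝ, E) 1 G := inferInstance
  exact isMIntegralCurve_Ioo_eq_of_contMDiff_boundaryless (t₀ := 0)
    (contMDiff_one_mulInvariantVectorField X) hc.2 hd.2 (hc.1.trans hd.1.symm)

/-- As functions of `t` both sides are integral curves of the same field, and they agree at `t = 0`.
-/
theorem IsOneParam.add {X : LieAlg E G} {c : ℝ → G} (hc : IsOneParam X c) (s t : ℝ) :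
    c (s + t) = c s * c t := by
  have hman : IsManifold 𝓘(ℝ, E) 1 G := inferInstance
  have h := isMIntegralCurve_Ioo_eq_of_contMDiff_boundaryless (t₀ := 0)
    (contMDiff_one_mulInvariantVectorField X) (hc.2.comp_add s)
    (IsMIntegralCurve.const_mul hc.2 (c s)) (by simp [hc.1])
  simpa [add_comm] using congrFun h t

theorem IsOneParam.neg {X : LieAlg E G} {c : ℝ → G} (hc : IsOneParam X c) (s : ℝ) :
    c (-s) = (c s)⁻¹ := by
  rw [eq_inv_iff_mul_eq_one, ← hc.add, neg_add_cancel, hc.1]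

/-- The curve `c` shows that the property chosen from in `exp` is satisfiable; uniqueness of
integral curves then fixes the chosen value. -/
theorem IsOneParam.exp_eq {X : LieAlg E G} {c : ℝ → G} (hc : IsOneParam X c) :
    exp X = c 1 := by
  obtain ⟨d, hd, hd1⟩ := Classical.epsilon_spec
    (p := fun g : G => ∃ c : ℝ → G, IsOneParam X c ∧ c 1 = g) ⟨c 1, c, hc, rfl⟩
  rw [hc.unique hd]
  exact hd1.symm

theorem IsOneParam.exp_smul {X : LieAlg E G} {c : ℝ → G} (hc : IsOneParam X c) (s : ℝ) :
    exp (s • X) = c s := by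
  rw [(hc.smul s).exp_eq, one_mul]

end OneParameterSubgroups

/-! ### The transadjoint representation and gradients of invariant functions -/

section Form

variable {E : Type*} [NormedAddCommGroup E] [NormedSpace ℝ E] [FiniteDimensional ℝ E]
  {G : Type*} [TopologicalSpace G] [ChartedSpace E G] [Group G]
  {B : LinearMap.BilinForm ℝ (LieAlg E G)}

theorem eq_of_form_eq (hB : B.Nondegenerate) {x y : LieAlg E G} (h : ∀ z, B x z = B y z) :
    x = y :=
  sub_eq_zero.1 (hB.1 _ fun z => by rw [map_sub, LinearMap.sub_apply, h, sub_self])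

theorem form_tau (hB : B.Nondegenerate) (g : G) (X Y : LieAlg E G) :
    B (tau hB g X) Y = B X (Ad g⁻¹ Y) :=
  LinearMap.BilinForm.isAdjointPairLeftAdjointOfNondegenerate B hB _ X Y

theorem form_grad (hB : B.Nondegenerate) (f : LieAlg E G → ℝ) (U Y : LieAlg E G) :
    B (grad hB f U) Y = fderiv ℝ f U Y := by
  have h := LinearMap.BilinForm.apply_toDual_symm_apply (hB := hB)
    (fderiv ℝ f U : LieAlg E G →ₗ[ℝ] ℝ) Y
  exact h

theorem IsSmooth.hasFDerivAt {f : LieAlg E G → ℝ} (hf : IsSmooth f) (U : LieAlg E G) :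
    HasFDerivAt (E := E) f (fderiv ℝ f U) U :=
  (ContDiff.differentiable hf (by simp) U).hasFDerivAt

theorem hasDerivAt_linearMap_apply {u : ℝ → LieAlg E G} {u' : LieAlg E G}
    {t₀ : ℝ} (hu : HasDerivAt u u' t₀) (L : LieAlg E G →ₗ[ℝ] LieAlg E G) :
    HasDerivAt (fun t => L (u t)) (L u') t₀ := by
  have key : ∀ (φ : E →ₗ[ℝ] E) (v : ℝ → E) (v' : E), HasDerivAt v v' t₀ →
      HasDerivAt (fun t => φ (v t)) (φ v') t₀ := fun φ v v' h =>
    HasFDerivAt.comp_hasDerivAt t₀ φ.toContinuousLinearMap.hasFDerivAt h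
  exact key L u u' hu

/-- Derivatives may be tested against the form: with the dual basis `d` of `b`, `x = ∑ B(x, bᵢ) dᵢ`.
-/
theorem hasDerivAt_of_form (hB : B.Nondegenerate) {u : ℝ → LieAlg E G} {u' : LieAlg E G} {t₀ : ℝ}
    (h : ∀ Z, HasDerivAt (fun t => B (u t) Z) (B u' Z) t₀) : HasDerivAt u u' t₀ := by
  let b := Module.finBasis ℝ (LieAlg E G)
  let d := B.dualBasis hB b
  have h1 : ∀ x : LieAlg E G, ∑ i, B x (b i) • d i = x := fun x => by
    conv_rhs => rw [← d.sum_repr x]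
    simp only [d, LinearMap.BilinForm.dualBasis_repr_apply]
  have h2 : ∀ v : _ → E, HasDerivAt (fun t => ∑ i, B (u t) (b i) • v i)
      (∑ i, B u' (b i) • v i) t₀ := fun v =>
    HasDerivAt.fun_sum fun i _ => (h (b i)).smul_const (v i)
  have h3 := h2 fun i => d i
  have h4 : ∀ (w : ℝ → E) (w' : E), w = u → w' = u' → HasDerivAt w w' t₀ →
      HasDerivAt (F := E) u u' t₀ := by
    rintro _ _ rfl rfl h
    exact h
  exact h4 _ _ (funext fun t => h1 (u t)) (h1 u') h3

theorem hasDerivAt_form_right {v : ℝ → E} {v' : E} {t₀ : ℝ} (h : HasDerivAt v v' t₀)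
    (B : LinearMap.BilinForm ℝ (LieAlg E G)) (w : LieAlg E G) :
    HasDerivAt (fun t => B w (v t)) (B w v') t₀ := by
  have key : ∀ φ : E →ₗ[ℝ] ℝ, HasDerivAt (fun t => φ (v t)) (φ v') t₀ := fun φ =>
    HasFDerivAt.comp_hasDerivAt t₀ φ.toContinuousLinearMap.hasFDerivAt h
  exact key (B w)

theorem hasDerivAt_comp {f : LieAlg E G → ℝ} (hf : IsSmooth f) {u : ℝ → LieAlg E G}
    {u' : LieAlg E G} {t₀ : ℝ} (hu : HasDerivAt u u' t₀) :
    HasDerivAt (fun t => f (u t)) (fderiv ℝ f (u t₀) u') t₀ :=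
  HasFDerivAt.comp_hasDerivAt (F := E) (E := ℝ) t₀ (hf.hasFDerivAt (u t₀)) hu

variable [LieGroup 𝓘(ℝ, E) ∞ G]

theorem tau_mul (hB : B.Nondegenerate) (g h : G) (X : LieAlg E G) :
    tau hB (g * h) X = tau hB g (tau hB h X) :=
  eq_of_form_eq hB fun z => by rw [form_tau, form_tau, form_tau, mul_inv_rev, Ad_mul]

theorem tau_one (hB : B.Nondegenerate) (X : LieAlg E G) : tau hB (1 : G) X = X :=
  eq_of_form_eq hB fun z => by rw [form_tau, inv_one, Ad_one]

variable [CompleteSpace E]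

theorem form_adT (hB : B.Nondegenerate) (X Y Z : LieAlg E G) :
    B (adT hB X Y) Z = B Y ⁅X, Z⁆ :=
  LinearMap.BilinForm.isAdjointPairLeftAdjointOfNondegenerate B hB _ Y Z

theorem adT_add (hB : B.Nondegenerate) (X Y U : LieAlg E G) :
    adT hB (X + Y) U = adT hB X U + adT hB Y U :=
  eq_of_form_eq hB fun z => by
    rw [map_add, LinearMap.add_apply, form_adT, form_adT, form_adT, add_lie, map_add]

theorem adT_smul (hB : B.Nondegenerate) (c : ℝ) (X U : LieAlg E G) :
    adT hB (c • X) U = c • adT hB X U :=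
  eq_of_form_eq hB fun z => by
    rw [map_smul, LinearMap.smul_apply, form_adT, form_adT, smul_lie, map_smul]

/-- `(X, U) ↦ adᵗ_X U` as a bilinear map. -/
def adTBilin (hB : B.Nondegenerate) : LieAlg E G →ₗ[ℝ] LieAlg E G →ₗ[ℝ] LieAlg E G where
  toFun X := adT hB X
  map_add' X Y := LinearMap.ext fun U => adT_add hB X Y U
  map_smul' c X := LinearMap.ext fun U => adT_smul hB c X U

/-- Paired with `Z`, the curve is `⟨W, Ad(γ⁻¹) Z⟩`, and `γ⁻¹` has velocity `-ξ`. -/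
theorem HasVelocityAtOne.hasDerivAt_tau (hB : B.Nondegenerate) {γ : ℝ → G} {ξ : LieAlg E G}
    {t₀ : ℝ} (h : HasVelocityAtOne γ ξ t₀) (W : LieAlg E G) :
    HasDerivAt (fun t => tau hB (γ t) W) (-adT hB ξ W) t₀ := by
  refine hasDerivAt_of_form hB fun Z => ?_
  simp only [form_tau]
  have h1 : B (-adT hB ξ W) Z = B W ⁅-ξ, Z⁆ := by
    rw [map_neg, LinearMap.neg_apply, form_adT, neg_lie, map_neg]
  rw [h1]
  exact hasDerivAt_form_right (E := E) (h.inv.hasDerivAt_Ad Z) B W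

/-- Constancy of `f` along `τ(γ) U`, with `γ` of velocity `Y`, reads `⟨U, [Y, ∇f(U)]⟩ = 0` for every
`Y`; now use skew-symmetry. -/
theorem adT_grad_self (hB : B.Nondegenerate) (hs : B.IsSymm) {f : LieAlg E G → ℝ}
    (hf : IsSmooth f) (hτ : IsTauInvariant hB f) (U : LieAlg E G) :
    adT hB (grad hB f U) U = 0 := by
  refine eq_of_form_eq hB fun Y => ?_
  obtain ⟨γ, hγ⟩ := exists_hasVelocityAtOne Y 0
  have h1 := hasDerivAt_comp hf (hγ.hasDerivAt_tau hB U)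
  simp only [hτ _ U, hγ.1, tau_one] at h1
  have h2 := h1.unique (hasDerivAt_const 0 (f U))
  rw [← form_grad hB, map_neg, neg_eq_zero, hs.eq, form_adT] at h2
  rw [form_adT, ← lie_skew, map_neg, h2, map_zero, LinearMap.zero_apply, neg_zero]

/-- Differentiating `f ∘ τ(g) = f` gives `⟨∇f(τ(g)U), τ(g)W⟩ = ⟨∇f(U), W⟩`, and `τ(g)` is the
adjoint of `Ad g⁻¹`. -/
theorem grad_tau (hB : B.Nondegenerate) (hs : B.IsSymm) {f : LieAlg E G → ℝ}
    (hf : IsSmooth f) (hτ : IsTauInvariant hB f) (g : G) (U : LieAlg E G) :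
    grad hB f (tau hB g U) = Ad g (grad hB f U) := by
  have h1 : ∀ W : LieAlg E G, fderiv ℝ f (tau hB g U) (tau hB g W) = fderiv ℝ f U W := by
    intro W
    have key : ∀ φ : E →ₗ[ℝ] E, (∀ x, f (φ x) = f x) → ∀ w : E,
        (fderiv ℝ f (φ U) : E →L[ℝ] ℝ) (φ w) = (fderiv ℝ f U : E →L[ℝ] ℝ) w := by
      intro φ hφ w
      have e1 : HasFDerivAt (fun x : E => f (φ x)) _ (U : E) :=
        HasFDerivAt.comp (E := E) (F := E) U (hf.hasFDerivAt (φ U)) φ.toContinuousLinearMap.hasFDerivAt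
      have e2 : (fun x : E => f (φ x)) = f := funext hφ
      rw [e2] at e1
      exact DFunLike.congr_fun (e1.unique (hf.hasFDerivAt U)) w
    exact key (tau hB g) (hτ g) W
  rw [← Ad_Ad_inv g (grad hB f (tau hB g U))]
  congr 1
  refine eq_of_form_eq hB fun W => ?_
  rw [hs.eq, ← form_tau hB, hs.eq, form_grad, h1, form_grad]

/-- Bilinear in the pair `(L ∇f(U), U)`, with `∇f` of class `C¹`. For `L` the projection onto `𝔤₊`
this is the regularity behind uniqueness of solutions. -/
theorem contDiff_adT_grad (hB : B.Nondegenerate) {f : LieAlg E G → ℝ} (hf : IsSmooth f)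
    (L : LieAlg E G →ₗ[ℝ] LieAlg E G) :
    ContDiff (E := E) (F := E) ℝ 1 (fun U => -adT hB (L (grad hB f U)) U) := by
  have two_le : (1 : WithTop ℕ∞) + 1 ≤ ∞ := by
    rw [one_add_one_eq_two]
    exact (WithTop.coe_le_coe.2 le_top : ((2 : ℕ∞) : WithTop ℕ∞) ≤ ∞)
  have hd : ContDiff ℝ 1 (fun U : E => (fderiv ℝ f U : E →L[ℝ] ℝ)) :=
    have key : ∀ φ : E → ℝ, ContDiff ℝ ∞ φ → ContDiff ℝ 1 (fderiv ℝ φ) :=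
      fun φ hφ => hφ.fderiv_right two_le
    key f hf
  have hg : ∀ φ : (E →ₗ[ℝ] ℝ) →ₗ[ℝ] E,
      ContDiff ℝ 1 (fun U : E => φ ((fderiv ℝ f U : E →L[ℝ] ℝ) : E →ₗ[ℝ] ℝ)) := by
    intro φ
    let ψ : (E →L[ℝ] ℝ) →ₗ[ℝ] E :=
      φ ∘ₗ (LinearMap.toContinuousLinearMap (𝕜 := ℝ) (E := E) (F' := ℝ)).symm.toLinearMap
    exact ψ.toContinuousLinearMap.contDiff.comp hd
  have hb : ∀ (T : E →ₗ[ℝ] E →ₗ[ℝ] E) (a : E → E), ContDiff ℝ 1 a →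
      ContDiff ℝ 1 (fun U : E => -(T (a U) U)) := by
    intro T a ha
    let T' : E →ₗ[ℝ] E →L[ℝ] E := (LinearMap.toContinuousLinearMap).toLinearMap ∘ₗ T
    exact ((T'.toContinuousLinearMap.contDiff.comp ha).clm_apply contDiff_id).neg
  exact hb (adTBilin hB) _ (hg (L ∘ₗ (B.toDual hB).symm.toLinearMap))

end Form

/-! ### The action of `G₋` on `𝔤₊^⊥`, the orbit form and Hamiltonian vector fields -/

namespace Splitting

variable {E : Type*} [NormedAddCommGroup E] [NormedSpace ℝ E] [FiniteDimensional ℝ E]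
  [CompleteSpace E]
  {G : Type*} [TopologicalSpace G] [ChartedSpace E G] [Group G] [LieGroup 𝓘(ℝ, E) ∞ G]
  {Em : Type*} [NormedAddCommGroup Em] [NormedSpace ℝ Em] [FiniteDimensional ℝ Em]
  {Gm : Type*} [TopologicalSpace Gm] [ChartedSpace Em Gm] [Group Gm]
  (D : Splitting E G Em Gm)

theorem dIncl_mem (Y : LieAlg Em Gm) : D.dIncl Y ∈ D.gm :=
  (D.isLieSubgroup.range_differential.le : LinearMap.range D.dIncl ≤ D.gm.toSubmodule) ⟨Y, rfl⟩

theorem exists_dIncl_eq {Z : LieAlg E G} (hZ : Z ∈ D.gm) : ∃ Y : LieAlg Em Gm, D.dIncl Y = Z :=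
  (D.isLieSubgroup.range_differential.ge : D.gm.toSubmodule ≤ LinearMap.range D.dIncl) hZ

theorem form_gp_right {U a : LieAlg E G} (hU : U ∈ D.gpPerp) (ha : a ∈ D.gp) :
    D.form U a = 0 := by
  rw [D.symm.eq]
  exact hU a ha

theorem mem_gpPerp_iff {U : LieAlg E G} : U ∈ D.gpPerp ↔ ∀ a ∈ D.gp, D.form U a = 0 :=
  ⟨fun hU _ ha => D.form_gp_right hU ha, fun h a ha => by
    rw [D.symm.eq]
    exact h a ha⟩

/-- The duality of `𝔤₊^⊥` and `𝔤₋`, as used below: elements of `𝔤₊^⊥` are compared by pairing with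
`𝔤₋`. -/
theorem eq_of_form_dIncl_eq {x y : LieAlg E G} (hx : x ∈ D.gpPerp) (hy : y ∈ D.gpPerp)
    (h : ∀ Y : LieAlg Em Gm, D.form x (D.dIncl Y) = D.form y (D.dIncl Y)) : x = y :=
  congrArg Subtype.val (D.ell_bijective.1 (a₁ := ⟨x, hx⟩) (a₂ := ⟨y, hy⟩) (LinearMap.ext h))

theorem gradPlus_add_gradMinus (f : LieAlg E G → ℝ) (U : LieAlg E G) :
    D.gradPlus f U + D.gradMinus f U = grad D.nondeg f U :=
  Submodule.projection_add_projection_eq_self D.isCompl _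

theorem gradPlus_mem (f : LieAlg E G → ℝ) (U : LieAlg E G) : D.gradPlus f U ∈ D.gp :=
  Submodule.projection_apply_mem D.isCompl _

theorem gradMinus_mem (f : LieAlg E G → ℝ) (U : LieAlg E G) : D.gradMinus f U ∈ D.gm :=
  Submodule.projection_apply_mem D.isCompl.symm _

theorem gradPlus_eq_of_add_eq {f : LieAlg E G → ℝ} {U a b : LieAlg E G} (ha : a ∈ D.gp)
    (hb : b ∈ D.gm) (h : a + b = grad D.nondeg f U) : D.gradPlus f U = a := by
  have h1 : D.gradPlus f U - a = b - D.gradMinus f U := by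
    rw [sub_eq_sub_iff_add_eq_add, D.gradPlus_add_gradMinus, ← h, add_comm]
  have h2 := Submodule.disjoint_def.1 D.isCompl.disjoint (D.gradPlus f U - a)
    (D.gp.toSubmodule.sub_mem (D.gradPlus_mem f U) ha)
    (by rw [h1]; exact D.gm.toSubmodule.sub_mem hb (D.gradMinus_mem f U))
  exact sub_eq_zero.1 h2

theorem form_grad_right {f : LieAlg E G → ℝ} {U V : LieAlg E G} (hV : V ∈ D.gpPerp) :
    D.form V (grad D.nondeg f U) = D.form V (D.gradMinus f U) := by
  rw [← D.gradPlus_add_gradMinus, map_add, D.form_gp_right hV (D.gradPlus_mem f U), zero_add]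

theorem projPerp_mem (x : LieAlg E G) : D.projPerp x ∈ D.gpPerp :=
  Submodule.projection_apply_mem D.isCompl_perp x

theorem projPerp_eq_self {x : LieAlg E G} (hx : x ∈ D.gpPerp) : D.projPerp x = x :=
  Submodule.projection_apply_of_mem_left D.isCompl_perp hx

theorem form_projPerp (x : LieAlg E G) (Y : LieAlg Em Gm) :
    D.form (D.projPerp x) (D.dIncl Y) = D.form x (D.dIncl Y) := by
  have h1 := Submodule.projection_add_projection_eq_self D.isCompl_perp x
  have h2 : D.gmPerp.projection D.gpPerp D.isCompl_perp.symm x ∈ D.gmPerp :=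
    Submodule.projection_apply_mem _ x
  have h3 : D.form (D.gmPerp.projection D.gpPerp D.isCompl_perp.symm x) (D.dIncl Y) = 0 := by
    rw [D.symm.eq]
    exact h2 _ (D.dIncl_mem Y)
  conv_rhs => rw [← h1, map_add, LinearMap.add_apply, h3, add_zero]
  rfl

theorem form_tauTilde (g : Gm) (X : D.gpPerp) (Y : LieAlg Em Gm) :
    D.form (D.tauTilde g X) (D.dIncl Y) = D.form X (D.dIncl (Ad g⁻¹ Y)) :=
  LinearMap.congr_fun (D.ellEquiv.apply_symm_apply (coAd g (D.ellEquiv X))) Y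

theorem adT_mem_gpPerp {X U : LieAlg E G} (hX : X ∈ D.gp) (hU : U ∈ D.gpPerp) :
    adT D.nondeg X U ∈ D.gpPerp :=
  D.mem_gpPerp_iff.2 fun a ha => by
    rw [form_adT]
    exact D.form_gp_right hU (D.gp.lie_mem hX ha)

variable [LieGroup 𝓘(ℝ, Em) ∞ Gm]

theorem tauTilde_mul (g h : Gm) (X : D.gpPerp) :
    D.tauTilde (g * h) X = D.tauTilde g (D.tauTilde h X) :=
  Subtype.ext (D.eq_of_form_dIncl_eq (Subtype.prop _) (Subtype.prop _) fun Y => by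
    rw [form_tauTilde, form_tauTilde, form_tauTilde, mul_inv_rev, Ad_mul])

theorem tauTilde_mem_orbit {P U : D.gpPerp} (hU : U ∈ D.orbit P) (g : Gm) :
    D.tauTilde g U ∈ D.orbit P := by
  obtain ⟨h, rfl⟩ := hU
  exact ⟨g * h, D.tauTilde_mul g h P⟩

theorem dIncl_Ad (g : Gm) (Y : LieAlg Em Gm) : D.dIncl (Ad g Y) = Ad (D.incl g) (D.dIncl Y) :=
  differential_Ad D.incl D.isLieSubgroup.contMDiff g Y

/-- Both sides lie in `𝔤₊^⊥` and pair with `𝔤₋` in the same way, because the differential of the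
inclusion intertwines the two adjoint representations. -/
theorem tauTilde_eq_projPerp (g : Gm) (X : D.gpPerp) :
    (D.tauTilde g X : LieAlg E G) = D.projPerp (tau D.nondeg (D.incl g) X) :=
  D.eq_of_form_dIncl_eq (Subtype.prop _) (D.projPerp_mem _) fun Y => by
    rw [form_tauTilde, form_projPerp, form_tau, dIncl_Ad, map_inv]

variable [T2Space Gm]

theorem hasDerivAt_orbitCurve (Y : LieAlg Em Gm) (U : D.gpPerp) :
    HasDerivAt (D.orbitCurve Y U) (-D.projPerp (adT D.nondeg (D.dIncl Y) U)) 0 := by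
  have : CompleteSpace Em := FiniteDimensional.complete ℝ Em
  obtain ⟨c, hc⟩ := exists_isOneParam Y
  have h1 := hasDerivAt_linearMap_apply ((hc.hasVelocityAtOne.map D.incl
    D.isLieSubgroup.contMDiff).hasDerivAt_tau D.nondeg (U : LieAlg E G)) D.projPerp
  rw [map_neg] at h1
  have h2 : D.orbitCurve Y U = fun t => D.projPerp (tau D.nondeg (D.incl (c t)) U) := by
    funext t
    rw [orbitCurve, hc.exp_smul, tauTilde_eq_projPerp]
  rw [h2]
  exact h1

theorem infGen_eq (Y : LieAlg Em Gm) (U : D.gpPerp) :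
    D.infGen Y U = -D.projPerp (adT D.nondeg (D.dIncl Y) U) := by
  have key : ∀ (u : ℝ → E) (u' : E), HasDerivAt u u' 0 → deriv u 0 = u' := fun _ _ h => h.deriv
  exact key _ _ (D.hasDerivAt_orbitCurve Y U)

theorem infGen_mem_gpPerp (Y : LieAlg Em Gm) (U : D.gpPerp) : D.infGen Y U ∈ D.gpPerp := by
  rw [infGen_eq]
  exact D.gpPerp.neg_mem (D.projPerp_mem _)

theorem form_infGen (Y Z : LieAlg Em Gm) (U : D.gpPerp) :
    D.form (D.infGen Y U) (D.dIncl Z) = -D.form U ⁅D.dIncl Y, D.dIncl Z⁆ := by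
  rw [infGen_eq, map_neg, LinearMap.neg_apply, form_projPerp, form_adT]

/-- `Y ↦ Ỹ(U)` as a linear map onto the tangent space of the orbit. -/
def tangentGenLinear (U : D.gpPerp) : LieAlg Em Gm →ₗ[ℝ] D.tangent U where
  toFun Y := D.tangentGen Y U
  map_add' Y Z := by
    apply Subtype.ext
    change D.infGen (Y + Z) U = D.infGen Y U + D.infGen Z U
    rw [infGen_eq, infGen_eq, infGen_eq, map_add, adT_add, map_add, neg_add]
  map_smul' c Y := by
    apply Subtype.ext
    change D.infGen (c • Y) U = c • D.infGen Y U
    rw [infGen_eq, infGen_eq, map_smul, adT_smul, map_smul, smul_neg]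

theorem tangentGenLinear_surjective (U : D.gpPerp) :
    Function.Surjective (D.tangentGenLinear U) := by
  have h : D.tangent U ≤ LinearMap.range ((D.tangent U).subtype ∘ₗ D.tangentGenLinear U) := by
    refine Submodule.span_le.2 ?_
    rintro _ ⟨Y, rfl⟩
    exact ⟨Y, rfl⟩
  rintro ⟨v, hv⟩
  obtain ⟨Y, hY⟩ := h hv
  exact ⟨Y, Subtype.ext hY⟩

theorem exists_tangentGen_eq {U : D.gpPerp} (v : D.tangent U) :
    ∃ Y : LieAlg Em Gm, D.tangentGen Y U = v := D.tangentGenLinear_surjective U v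

/-- A linear section `r` of `Y ↦ Ỹ(U)` defines a candidate form. It does not depend on
representatives: by `form_infGen`, `⟨U, [Y, Z]⟩` depends on `Y` only through `Ỹ(U)`, and
skew-symmetry settles the other slot. -/
theorem exists_isOrbitForm (U : D.gpPerp) : ∃ Ω, D.IsOrbitForm U Ω := by
  obtain ⟨r, hr⟩ := LinearMap.exists_rightInverse_of_surjective (D.tangentGenLinear U)
    (LinearMap.range_eq_top.2 (D.tangentGenLinear_surjective U))
  have hr' : ∀ v, D.infGen (r v) U = v := fun v => congrArg Subtype.val (LinearMap.congr_fun hr v)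
  refine ⟨LinearMap.mk₂ ℝ (fun v w => D.form U ⁅D.dIncl (r v), D.dIncl (r w)⁆)
    (fun _ _ _ => by simp only [map_add, add_lie]) (fun _ _ _ => by simp only [map_smul, smul_lie])
    (fun _ _ _ => by simp only [map_add, lie_add])
    (fun _ _ _ => by simp only [map_smul, lie_smul]), fun Y Z => ?_⟩
  have hleft : ∀ Y Y' Z : LieAlg Em Gm, D.infGen Y U = D.infGen Y' U →
      D.form U ⁅D.dIncl Y, D.dIncl Z⁆ = D.form U ⁅D.dIncl Y', D.dIncl Z⁆ := by
    intro Y Y' Z h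
    rw [← neg_inj, ← form_infGen, h, form_infGen]
  have hright : ∀ Y Z Z' : LieAlg Em Gm, D.infGen Z U = D.infGen Z' U →
      D.form U ⁅D.dIncl Y, D.dIncl Z⁆ = D.form U ⁅D.dIncl Y, D.dIncl Z'⁆ := by
    intro Y Z Z' h
    rw [← lie_skew, map_neg, hleft Z Z' Y h, ← map_neg, lie_skew]
  rw [LinearMap.mk₂_apply]
  exact (hleft _ Y _ (hr' _)).trans (hright _ _ Z (hr' _))

theorem isOrbitForm_orbitForm (U : D.gpPerp) : D.IsOrbitForm U (D.orbitForm U) :=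
  Classical.epsilon_spec (D.exists_isOrbitForm U)

theorem orbitForm_tangentGen (U : D.gpPerp) (Y Z : LieAlg Em Gm) :
    D.orbitForm U (D.tangentGen Y U) (D.tangentGen Z U) = -D.form (D.infGen Y U) (D.dIncl Z) := by
  rw [D.isOrbitForm_orbitForm U, form_infGen, neg_neg]

theorem orbitForm_isAlt (U : D.gpPerp) : (D.orbitForm U).IsAlt := by
  intro v
  obtain ⟨Y, rfl⟩ := D.exists_tangentGen_eq v
  rw [D.isOrbitForm_orbitForm U, lie_self, map_zero]

/-- If `Ỹ(U)` is in the left kernel, it pairs to zero with all of `𝔤₋`, hence vanishes by duality.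
Alternation covers the right kernel. -/
theorem orbitForm_nondegenerate (U : D.gpPerp) : (D.orbitForm U).Nondegenerate := by
  have hl : ∀ v, (∀ w, D.orbitForm U v w = 0) → v = 0 := by
    intro v hv
    obtain ⟨Y, rfl⟩ := D.exists_tangentGen_eq v
    refine Subtype.ext (D.eq_of_form_dIncl_eq (D.infGen_mem_gpPerp Y U) D.gpPerp.zero_mem
      fun Z => ?_)
    change D.form (D.infGen Y U) (D.dIncl Z) = D.form 0 (D.dIncl Z)
    rw [← neg_inj, ← orbitForm_tangentGen, hv, map_zero, LinearMap.zero_apply, neg_zero]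
  refine ⟨hl, fun w hw => hl w fun v => ?_⟩
  rw [← LinearMap.IsAlt.neg (D.orbitForm_isAlt U), hw, neg_zero]

theorem orbitCurve_zero (Y : LieAlg Em Gm) (U : D.gpPerp) : D.orbitCurve Y U 0 = U := by
  have : CompleteSpace Em := FiniteDimensional.complete ℝ Em
  obtain ⟨c, hc⟩ := exists_isOneParam Y
  rw [orbitCurve, hc.exp_smul, hc.1, tauTilde_eq_projPerp, map_one, tau_one,
    D.projPerp_eq_self U.2]

/-- The chain rule gives `⟨∇f(U), Ỹ(U)⟩`; the `𝔤₊` component of the gradient drops out because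
`Ỹ(U)` lies in `𝔤₊^⊥`. -/
theorem deriv_orbitCurve {f : LieAlg E G → ℝ} (hf : IsSmooth f) (Y : LieAlg Em Gm)
    (U : D.gpPerp) :
    deriv (fun s => f (D.orbitCurve Y U s)) 0 = D.form (D.infGen Y U) (D.gradMinus f U) := by
  rw [(hasDerivAt_comp hf (D.hasDerivAt_orbitCurve Y U)).deriv, ← infGen_eq, orbitCurve_zero,
    ← form_grad D.nondeg, D.symm.eq, D.form_grad_right (D.infGen_mem_gpPerp Y U)]

theorem isHamiltonianVector_neg_tangentGen {f : LieAlg E G → ℝ} (hf : IsSmooth f) (U : D.gpPerp)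
    {Z : LieAlg Em Gm} (hZ : D.dIncl Z = D.gradMinus f U) :
    D.IsHamiltonianVector f U (-D.tangentGen Z U) := by
  intro Y
  rw [D.deriv_orbitCurve hf, map_neg, orbitForm_tangentGen, neg_neg, hZ]

theorem IsHamiltonianVector.unique {f : LieAlg E G → ℝ} {U : D.gpPerp} {X X' : D.tangent U}
    (h : D.IsHamiltonianVector f U X) (h' : D.IsHamiltonianVector f U X') : X = X' := by
  refine sub_eq_zero.1 ((D.orbitForm_nondegenerate U).2 _ fun v => ?_)
  obtain ⟨Y, rfl⟩ := D.exists_tangentGen_eq v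
  rw [map_sub, ← h Y, ← h' Y, sub_self]

theorem hamiltonianField_eq_neg_tangentGen {f : LieAlg E G → ℝ} (hf : IsSmooth f) (U : D.gpPerp)
    {Z : LieAlg Em Gm} (hZ : D.dIncl Z = D.gradMinus f U) :
    D.hamiltonianField f U = -D.tangentGen Z U := by
  have h := D.isHamiltonianVector_neg_tangentGen hf U hZ
  exact IsHamiltonianVector.unique D
    (Classical.epsilon_spec (p := D.IsHamiltonianVector f U) ⟨_, h⟩) h

theorem existsUnique_isHamiltonianVector {f : LieAlg E G → ℝ} (hf : IsSmooth f) (U : D.gpPerp) :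
    ∃! X : D.tangent U, D.IsHamiltonianVector f U X := by
  obtain ⟨Z, hZ⟩ := D.exists_dIncl_eq (D.gradMinus_mem f U)
  exact ⟨_, D.isHamiltonianVector_neg_tangentGen hf U hZ, fun X hX =>
    IsHamiltonianVector.unique D hX (D.isHamiltonianVector_neg_tangentGen hf U hZ)⟩

theorem isHamiltonianVector_hamiltonianField {f : LieAlg E G → ℝ} (hf : IsSmooth f)
    (U : D.gpPerp) : D.IsHamiltonianVector f U (D.hamiltonianField f U) :=
  Classical.epsilon_spec (D.existsUnique_isHamiltonianVector hf U).exists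

theorem hamiltonianField_eq_projPerp {f : LieAlg E G → ℝ} (hf : IsSmooth f) (U : D.gpPerp) :
    (D.hamiltonianField f U : LieAlg E G) =
      D.projPerp (adT D.nondeg (D.gradMinus f U) U) := by
  obtain ⟨Z, hZ⟩ := D.exists_dIncl_eq (D.gradMinus_mem f U)
  rw [D.hamiltonianField_eq_neg_tangentGen hf U hZ, ← hZ]
  change -D.infGen Z U = _
  rw [infGen_eq, neg_neg]

theorem adT_gradMinus_eq {f : LieAlg E G → ℝ} (hf : IsSmooth f) (hτ : IsTauInvariant D.nondeg f)
    (U : LieAlg E G) :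
    adT D.nondeg (D.gradMinus f U) U = -adT D.nondeg (D.gradPlus f U) U := by
  have h := adT_grad_self D.nondeg D.symm hf hτ U
  rw [← D.gradPlus_add_gradMinus, adT_add] at h
  exact eq_neg_of_add_eq_zero_right h

/-- The projection acts trivially here: `adᵗ` of an element of the subalgebra `𝔤₊` preserves `𝔤₊^⊥`.
-/
theorem hamiltonianField_eq_adT {f : LieAlg E G → ℝ} (hf : IsSmooth f)
    (hτ : IsTauInvariant D.nondeg f) (U : D.gpPerp) :
    (D.hamiltonianField f U : LieAlg E G) = -adT D.nondeg (D.gradPlus f U) U := by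
  rw [D.hamiltonianField_eq_projPerp hf, D.adT_gradMinus_eq hf hτ]
  exact D.projPerp_eq_self (D.gpPerp.neg_mem (D.adT_mem_gpPerp (D.gradPlus_mem f U) U.2))

/-- The bracket is `⟨U, [∇f₁₋, ∇f₂₋]⟩`. Invariance of `f₁`, then of `f₂`, replaces each minus
component by minus the plus component, leaving `adᵗ_{∇f₂₊} U ∈ 𝔤₊^⊥` paired with `∇f₁₊ ∈ 𝔤₊`. -/
theorem poissonBracket_eq_zero {f₁ f₂ : LieAlg E G → ℝ} (hf₁ : IsSmooth f₁) (hf₂ : IsSmooth f₂)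
    (hτ₁ : IsTauInvariant D.nondeg f₁) (hτ₂ : IsTauInvariant D.nondeg f₂) (U : D.gpPerp) :
    D.poissonBracket f₁ f₂ U = 0 := by
  obtain ⟨Y, hY⟩ := D.exists_dIncl_eq (D.gradMinus_mem f₁ U)
  obtain ⟨Z, hZ⟩ := D.exists_dIncl_eq (D.gradMinus_mem f₂ U)
  rw [poissonBracket, D.hamiltonianField_eq_neg_tangentGen hf₁ U hY,
    D.hamiltonianField_eq_neg_tangentGen hf₂ U hZ, map_neg, map_neg, LinearMap.neg_apply, neg_neg,
    D.isOrbitForm_orbitForm U, hY, hZ, ← form_adT D.nondeg, D.adT_gradMinus_eq hf₁ hτ₁, map_neg,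
    LinearMap.neg_apply, form_adT, ← lie_skew, map_neg, neg_neg, ← form_adT D.nondeg,
    D.adT_gradMinus_eq hf₂ hτ₂, map_neg, LinearMap.neg_apply,
    D.form_gp_right (D.adT_mem_gpPerp (D.gradPlus_mem f₂ U) U.2) (D.gradPlus_mem f₁ U), neg_zero]

end Splitting

/-! ### Invariance under subgroups and points fixed by one-parameter groups -/

section LieSubgroup

variable {E : Type*} [NormedAddCommGroup E] [NormedSpace ℝ E] [CompleteSpace E]
  {G : Type*} [TopologicalSpace G] [ChartedSpace E G] [Group G] [LieGroup 𝓘(ℝ, E) ∞ G]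
  {F : Type*} [NormedAddCommGroup F] [NormedSpace ℝ F]
  {K : Type*} [TopologicalSpace K] [ChartedSpace F K] [Group K]
  {ι : K →* G} {𝔥 : LieSubalgebra ℝ (LieAlg E G)}

theorem IsLieSubgroup.differential_mem (hι : IsLieSubgroup (F := F) ι 𝔥) (X : LieAlg F K) :
    differential (E := E) ι X ∈ 𝔥 :=
  (hι.range_differential.le :
    LinearMap.range (differential (E := E) (F := F) ι) ≤ 𝔥.toSubmodule) ⟨X, rfl⟩

/-- Conjugation by `ι k` on the image of `ι` comes from conjugation in `K`, so no connectedness is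
needed. -/
theorem IsLieSubgroup.Ad_mem [LieGroup 𝓘(ℝ, F) ∞ K] (hι : IsLieSubgroup (F := F) ι 𝔥) (k : K)
    {X : LieAlg E G} (hX : X ∈ 𝔥) : Ad (ι k) X ∈ 𝔥 := by
  obtain ⟨Y, rfl⟩ := (hι.range_differential.ge :
    𝔥.toSubmodule ≤ LinearMap.range (differential (E := E) (F := F) ι)) hX
  rw [← differential_Ad ι hι.contMDiff]
  exact hι.differential_mem _

end LieSubgroup

section Stabilizer

variable {E : Type*} [NormedAddCommGroup E] [NormedSpace ℝ E] [FiniteDimensional ℝ E]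
  [CompleteSpace E]
  {G : Type*} [TopologicalSpace G] [T2Space G] [ChartedSpace E G] [Group G]
  [LieGroup 𝓘(ℝ, E) ∞ G] {B : LinearMap.BilinForm ℝ (LieAlg E G)}

/-- The one-parameter group of `X` fixes `U` under `τ` if `adᵗ_X U = 0`. -/
theorem IsOneParam.tau_eq_self (hB : B.Nondegenerate) {X U : LieAlg E G} {c : ℝ → G}
    (hc : IsOneParam X c) (h : adT hB X U = 0) (s : ℝ) : tau hB (c s) U = U := by
  have hd : ∀ t, HasDerivAt (fun t => tau hB (c t) U) 0 t := by
    intro t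
    -- Writing `c r = c t * c (r - t)` reduces the derivative at `t` to the one at the identity.
    have h1 := hc.hasVelocityAtOne.comp_affine 1 (-t) (s₀ := t) (by ring)
    have h2 := hasDerivAt_linearMap_apply (h1.hasDerivAt_tau hB U) (tau hB (c t))
    rw [one_smul, h, neg_zero, map_zero] at h2
    have h3 : ∀ r, tau hB (c t) (tau hB (c (1 * r + -t)) U) = tau hB (c r) U := by
      intro r
      rw [← tau_mul, ← hc.add]
      congr 2
      ring_nf
    simpa only [h3] using h2
  have key : ∀ w : ℝ → E, (∀ t, HasDerivAt w 0 t) → w s = w 0 := fun w hw =>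
    is_const_of_deriv_eq_zero (fun t => (hw t).differentiableAt) (fun t => (hw t).deriv) s 0
  have h4 := key _ hd
  simp only [hc.1, tau_one] at h4
  exact h4

end Stabilizer

/-! ### Solution by factorization -/

namespace Splitting

variable {E : Type*} [NormedAddCommGroup E] [NormedSpace ℝ E] [FiniteDimensional ℝ E]
  [CompleteSpace E]
  {G : Type*} [TopologicalSpace G] [T2Space G] [ChartedSpace E G] [Group G]
  [LieGroup 𝓘(ℝ, E) ∞ G]
  {Ep : Type*} [NormedAddCommGroup Ep] [NormedSpace ℝ Ep]
  {Gp : Type*} [TopologicalSpace Gp] [ChartedSpace Ep Gp] [Group Gp]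
  [LieGroup 𝓘(ℝ, Ep) ∞ Gp]
  {Em : Type*} [NormedAddCommGroup Em] [NormedSpace ℝ Em] [FiniteDimensional ℝ Em]
  {Gm : Type*} [TopologicalSpace Gm] [ChartedSpace Em Gm] [Group Gm]
  [LieGroup 𝓘(ℝ, Em) ∞ Gm]
  (D : Splitting E G Em Gm)

theorem tau_mem_gpPerp {inclp : Gp →* G} (hinclp : IsLieSubgroup (F := Ep) inclp D.gp) (g : Gp)
    {U : LieAlg E G} (hU : U ∈ D.gpPerp) : tau D.nondeg (inclp g) U ∈ D.gpPerp :=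
  D.mem_gpPerp_iff.2 fun a ha => by
    rw [form_tau, ← map_inv]
    exact D.form_gp_right hU (hinclp.Ad_mem g⁻¹ ha)

/-- If `k = h · exp (-s ∇f(U₀))` with differentiable `h` in `G₊` and `k` in `G₋`, then
`s ↦ τ(h(s)) U₀` solves the Hamiltonian equation. -/
theorem hasDerivAt_tau_of_factorization {inclp : Gp →* G}
    (hinclp : IsLieSubgroup (F := Ep) inclp D.gp) {f : LieAlg E G → ℝ} (hf : IsSmooth f)
    (hτ : IsTauInvariant D.nondeg f) {U₀ : LieAlg E G} {c : ℝ → G}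
    (hc : IsOneParam (grad D.nondeg f U₀) c) {h : ℝ → Gp} {k : ℝ → Gm}
    (hh : MDifferentiable 𝓘(ℝ, ℝ) 𝓘(ℝ, Ep) h) (hk : MDifferentiable 𝓘(ℝ, ℝ) 𝓘(ℝ, Em) k)
    (hhk : ∀ t, D.incl (k t) = inclp (h t) * c (-t)) (s : ℝ) :
    HasDerivAt (fun t => tau D.nondeg (inclp (h t)) U₀)
      (-adT D.nondeg (D.gradPlus f (tau D.nondeg (inclp (h s)) U₀))
        (tau D.nondeg (inclp (h s)) U₀)) s := by
  -- Right translation by `(h s)⁻¹` and `(k s)⁻¹` brings the curves to the identity at time `s`;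
  -- their velocities `η`, `κ` are the right logarithmic derivatives.
  have hh' : MDifferentiableAt 𝓘(ℝ, ℝ) 𝓘(ℝ, Ep) (fun t => h t * (h s)⁻¹) s :=
    MDifferentiableAt.comp s (g := fun x : Gp => x * (h s)⁻¹)
      ((contMDiff_mul_right (I := 𝓘(ℝ, Ep)) (n := ∞)).mdifferentiable (by simp) _) (hh s)
  have hk' : MDifferentiableAt 𝓘(ℝ, ℝ) 𝓘(ℝ, Em) (fun t => k t * (k s)⁻¹) s :=
    MDifferentiableAt.comp s (g := fun x : Gm => x * (k s)⁻¹)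
      ((contMDiff_mul_right (I := 𝓘(ℝ, Em)) (n := ∞)).mdifferentiable (by simp) _) (hk s)
  obtain ⟨η, hη⟩ := exists_hasVelocityAtOne_of_mdifferentiableAt (mul_inv_cancel (h s)) hh'
  obtain ⟨κ, hκ⟩ := exists_hasVelocityAtOne_of_mdifferentiableAt (mul_inv_cancel (k s)) hk'
  have hη' := hη.map inclp hinclp.contMDiff
  have hκ' := hκ.map D.incl D.isLieSubgroup.contMDiff
  have h1 := hη'.mul ((hc.hasVelocityAtOne.comp_affine (-1) s (s₀ := s) (by ring)).conj
    (inclp (h s)))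
  have h2 : ∀ t, inclp (h t * (h s)⁻¹) * (inclp (h s) * c (-1 * t + s) * (inclp (h s))⁻¹)
      = D.incl (k t * (k s)⁻¹) := by
    intro t
    rw [map_mul, map_mul, map_inv, map_inv, hhk, hhk, hc.add, hc.neg s, neg_one_mul]
    group
  simp only [h2] at h1
  -- The factorization yields `κ = η - Ad(h)∇f(U₀)`, so `∇f(τ(h)U₀) = η - κ` is the decomposition of
  -- the gradient along `𝔤₊ ⊕ 𝔤₋`.
  have h3 : D.gradPlus f (tau D.nondeg (inclp (h s)) U₀) = differential inclp η := by
    refine D.gradPlus_eq_of_add_eq (hinclp.differential_mem η)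
      (D.gm.toSubmodule.neg_mem (D.isLieSubgroup.differential_mem κ)) ?_
    rw [hκ'.unique h1, grad_tau D.nondeg D.symm hf hτ, neg_one_smul, map_neg]
    abel
  rw [h3]
  have h4 := hη'.hasDerivAt_tau D.nondeg (tau D.nondeg (inclp (h s)) U₀)
  have h5 : ∀ t, tau D.nondeg (inclp (h t * (h s)⁻¹)) (tau D.nondeg (inclp (h s)) U₀)
      = tau D.nondeg (inclp (h t)) U₀ := by
    intro t
    rw [← tau_mul, ← map_mul, inv_mul_cancel_right]
  simpa only [h5] using h4

/-- As `c s` fixes `U₀`, `τ(k)U₀ = τ(h)U₀`; this lies in `𝔤₊^⊥`, where the projection in `τ̃` does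
nothing. It is what keeps the solution on the orbit. -/
theorem tau_eq_tauTilde_of_factorization {inclp : Gp →* G}
    (hinclp : IsLieSubgroup (F := Ep) inclp D.gp) {f : LieAlg E G → ℝ} (hf : IsSmooth f)
    (hτ : IsTauInvariant D.nondeg f) {U₀ : D.gpPerp} {c : ℝ → G}
    (hc : IsOneParam (grad D.nondeg f U₀) c) {h : Gp} {k : Gm} {s : ℝ}
    (hhk : D.incl k = inclp h * c s) :
    (D.tauTilde k U₀ : LieAlg E G) = tau D.nondeg (inclp h) U₀ := by
  rw [tauTilde_eq_projPerp, hhk, tau_mul,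
    hc.tau_eq_self D.nondeg (adT_grad_self D.nondeg D.symm hf hτ U₀),
    D.projPerp_eq_self (D.tau_mem_gpPerp hinclp h U₀.2)]

theorem eqOn_of_hasDerivAt {f : LieAlg E G → ℝ} (hf : IsSmooth f) {u v : ℝ → LieAlg E G}
    {a b t₀ : ℝ} (ht₀ : t₀ ∈ Set.Ioo a b)
    (hu : ∀ s ∈ Set.Ioo a b, HasDerivAt u (-adT D.nondeg (D.gradPlus f (u s)) (u s)) s)
    (hv : ∀ s ∈ Set.Ioo a b, HasDerivAt v (-adT D.nondeg (D.gradPlus f (v s)) (v s)) s)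
    (h : u t₀ = v t₀) : Set.EqOn u v (Set.Ioo a b) :=
  eqOn_Ioo_of_hasDerivAt_of_contDiff (E := E)
    (F := fun U => -adT D.nondeg (D.gradPlus f U) U)
    (contDiff_adT_grad D.nondeg hf (D.gp.toSubmodule.projection D.gm.toSubmodule D.isCompl))
    ht₀ hu hv h

end Splitting

end Transadjoint

end

theorem theorem3
    {E : Type*} [NormedAddCommGroup E] [NormedSpace ℝ E] [FiniteDimensional ℝ E] [CompleteSpace E]
    {G : Type*} [TopologicalSpace G] [T2Space G] [ChartedSpace E G] [Group G]
    [LieGroup 𝓘(ℝ, E) ∞ G]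
    {Ep : Type*} [NormedAddCommGroup Ep] [NormedSpace ℝ Ep] [FiniteDimensional ℝ Ep]
    {Gp : Type*} [TopologicalSpace Gp] [T2Space Gp] [ChartedSpace Ep Gp] [Group Gp]
    [LieGroup 𝓘(ℝ, Ep) ∞ Gp]
    {Em : Type*} [NormedAddCommGroup Em] [NormedSpace ℝ Em] [FiniteDimensional ℝ Em]
    {Gm : Type*} [TopologicalSpace Gm] [T2Space Gm] [ChartedSpace Em Gm] [Group Gm]
    [LieGroup 𝓘(ℝ, Em) ∞ Gm]
    (D : Transadjoint.Splitting E G Em Gm)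
    (inclp : Gp →* G) (hinclp : Transadjoint.IsLieSubgroup (F := Ep) inclp D.gp)
    (P : D.gpPerp) (f : Transadjoint.LieAlg E G → ℝ) (hf : Transadjoint.IsSmooth f) :
    -- the orbit symplectic form exists, and is alternating and nondegenerate
    (∀ U ∈ D.orbit P,
      (∀ Y : Transadjoint.LieAlg Em Gm, HasDerivAt (D.orbitCurve Y U) (D.infGen Y U) 0) ∧
      D.IsOrbitForm U (D.orbitForm U) ∧ (D.orbitForm U).IsAlt ∧ (D.orbitForm U).Nondegenerate) ∧
    -- (1)
    (∀ U ∈ D.orbit P,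
      (∃! X : D.tangent U, D.IsHamiltonianVector f U X) ∧
      D.IsHamiltonianVector f U (D.hamiltonianField f U) ∧
      (∃ Y : Transadjoint.LieAlg Em Gm, D.dIncl Y = D.gradMinus f U ∧
        (D.hamiltonianField f U : Transadjoint.LieAlg E G) = - D.infGen Y U) ∧
      (D.hamiltonianField f U : Transadjoint.LieAlg E G) =
        D.projPerp (Transadjoint.adT D.nondeg (D.gradMinus f U) U)) ∧
    -- (2)
    (Transadjoint.IsTauInvariant D.nondeg f →
      ∀ U ∈ D.orbit P,
        (D.hamiltonianField f U : Transadjoint.LieAlg E G) =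
          - Transadjoint.adT D.nondeg (D.gradPlus f U) U ∧
        (D.hamiltonianField f U : Transadjoint.LieAlg E G) =
          Transadjoint.adT D.nondeg (D.gradMinus f U) U) ∧
    -- (3)
    (∀ f₁ f₂ : Transadjoint.LieAlg E G → ℝ,
      Transadjoint.IsSmooth f₁ → Transadjoint.IsSmooth f₂ →
      Transadjoint.IsTauInvariant D.nondeg f₁ → Transadjoint.IsTauInvariant D.nondeg f₂ →
      ∀ U ∈ D.orbit P, D.poissonBracket f₁ f₂ U = 0) ∧
    -- (4)
    ((∃ Φ : Diffeomorph (𝓘(ℝ, Ep).prod 𝓘(ℝ, Em)) 𝓘(ℝ, E) (Gp × Gm) G ∞,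
        ∀ (a : Gp) (b : Gm), Φ (a, b) = inclp a * D.incl b) →
      Transadjoint.IsTauInvariant D.nondeg f →
      ∀ U₀ ∈ D.orbit P,
        ∃ (gp : ℝ → Gp) (gm : ℝ → Gm),
          -- `(gp s, gm s)` is the unique factorization of `exp (s ∇f(U₀))`
          (∀ (s : ℝ) (a : Gp) (b : Gm),
            Transadjoint.exp (s • Transadjoint.grad D.nondeg f U₀) = inclp a * D.incl b ↔
              a = gp s ∧ b = gm s) ∧
          ∃ u : ℝ → Transadjoint.LieAlg E G,
            (∀ s : ℝ, u s = Transadjoint.tau D.nondeg (inclp (gp (-s)))⁻¹ U₀) ∧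
            u 0 = U₀ ∧
            (∀ s : ℝ, HasDerivAt u (- Transadjoint.adT D.nondeg (D.gradPlus f (u s)) (u s)) s) ∧
            (∀ s : ℝ, ∃ U ∈ D.orbit P, (U : Transadjoint.LieAlg E G) = u s) ∧
            -- it is the only solution, on every open interval around `0`
            (∀ (v : ℝ → Transadjoint.LieAlg E G) (a b : ℝ), a < 0 → 0 < b → v 0 = U₀ →
              (∀ s ∈ Set.Ioo a b,
                HasDerivAt v (- Transadjoint.adT D.nondeg (D.gradPlus f (v s)) (v s)) s) →
              ∀ s ∈ Set.Ioo a b, v s = u s)) := by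
  refine ⟨fun U _ => ⟨fun Y => ?_, D.isOrbitForm_orbitForm U, D.orbitForm_isAlt U,
    D.orbitForm_nondegenerate U⟩, fun U _ => ⟨D.existsUnique_isHamiltonianVector hf U,
    D.isHamiltonianVector_hamiltonianField hf U, ?_, D.hamiltonianField_eq_projPerp hf U⟩,
    fun hτ U _ => ⟨D.hamiltonianField_eq_adT hf hτ U, ?_⟩,
    fun f₁ f₂ hf₁ hf₂ hτ₁ hτ₂ U _ => D.poissonBracket_eq_zero hf₁ hf₂ hτ₁ hτ₂ U, ?_⟩
  · rw [D.infGen_eq]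
    exact D.hasDerivAt_orbitCurve Y U
  · obtain ⟨Y, hY⟩ := D.exists_dIncl_eq (D.gradMinus_mem f U)
    exact ⟨Y, hY, by rw [D.hamiltonianField_eq_neg_tangentGen hf U hY]; rfl⟩
  · rw [D.hamiltonianField_eq_adT hf hτ, D.adT_gradMinus_eq hf hτ]
  rintro ⟨Φ, hΦ⟩ hτ U₀ hU₀
  obtain ⟨c, hc⟩ := Transadjoint.exists_isOneParam (Transadjoint.grad D.nondeg f U₀)
  have hfac : ∀ s, inclp (Φ.symm (c s)).1 * D.incl (Φ.symm (c s)).2 = c s := fun s => by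
    rw [← hΦ, Prod.mk.eta, Φ.apply_symm_apply]
  have hdiff : MDifferentiable 𝓘(ℝ, ℝ) (𝓘(ℝ, Ep).prod 𝓘(ℝ, Em)) fun t => Φ.symm (c (-t)) :=
    (Φ.symm.contMDiff.mdifferentiable (by simp)).comp
      (hc.mdifferentiable.comp differentiable_neg.mdifferentiable)
  have hh : MDifferentiable 𝓘(ℝ, ℝ) 𝓘(ℝ, Ep) fun t => (Φ.symm (c (-t))).1⁻¹ :=
    ((contMDiff_inv 𝓘(ℝ, Ep) ∞).mdifferentiable (by simp)).comp
      (mdifferentiable_fst.comp hdiff)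
  have hk : MDifferentiable 𝓘(ℝ, ℝ) 𝓘(ℝ, Em) fun t => (Φ.symm (c (-t))).2 :=
    mdifferentiable_snd.comp hdiff
  -- `g₊(-t) g₋(-t) = c(-t)`, solved for the factor in `G₋`.
  have hhk : ∀ t, D.incl (Φ.symm (c (-t))).2 = inclp (Φ.symm (c (-t))).1⁻¹ * c (-t) := fun t => by
    rw [map_inv, eq_inv_mul_iff_mul_eq, hfac]
  have h0 : Transadjoint.tau D.nondeg (inclp (Φ.symm (c (-0))).1⁻¹) U₀ = U₀ := by
    have h1 : Φ.symm (1 : G) = (1, 1) := by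
      have h2 : Φ (1, 1) = 1 := by rw [hΦ, map_one, map_one, mul_one]
      rw [← h2, Φ.symm_apply_apply]
    rw [neg_zero, hc.1, h1, inv_one, map_one, Transadjoint.tau_one]
  have hu := D.hasDerivAt_tau_of_factorization hinclp hf hτ hc hh hk hhk
  refine ⟨fun s => (Φ.symm (c s)).1, fun s => (Φ.symm (c s)).2, fun s a b => ?_,
    fun s => Transadjoint.tau D.nondeg (inclp (Φ.symm (c (-s))).1⁻¹) U₀,
    fun s => by simp only [map_inv], h0, hu, fun s => ⟨_, D.tauTilde_mem_orbit hU₀ _,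
      D.tau_eq_tauTilde_of_factorization hinclp hf hτ hc (hhk s)⟩, ?_⟩
  -- Existence and uniqueness of the factorization are the bijectivity of `Φ`.
  · rw [hc.exp_smul, ← hΦ]
    constructor
    · intro h
      simp only [h, Φ.symm_apply_apply, and_self]
    · rintro ⟨rfl, rfl⟩
      rw [Prod.mk.eta, Φ.apply_symm_apply]
  · intro v a b ha hb hv0 hv
    exact D.eqOn_of_hasDerivAt hf ⟨ha, hb⟩ hv (fun s _ => hu s) (hv0.trans h0.symm)
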